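/- **Setting.** Let $\mathcal T_h$ be a finite face-to-face triangulation of a bounded polygonal domain $\Omega\subset\mathbb R^2$ (the triangles are closed and nondegenerate, two triangles meet in nothing, a common vertex or a common edge, and $\Omega$ is the connected interior of their union). Let $\mathcal S_h$ be its set of vertices. The boundary of $\Omega$ does not touch itself, so that for each $z\in\mathcal S_h$ the triangles having $z$ as a vertex can be enumerated as $T_1,\dots,T_N$ with $T_j,T_{j+1}$ sharing an edge for $1\le j<N$, where $T_N,T_1$ share an edge if $z\in\Omega$, and $T_1,T_N$ each have an edge with endpoint $z$ on $\partial\Omega$ if $z\in\partial\Omega$. Let $\theta_j$ be the angle of $T_j$ at $z$. Put $$\Gamma(z)=\max_j|\theta_j+\theta_{j+1}-\pi|,\qquad \Theta(z)=\max_j|\sin(\theta_j+\theta_{j+1})|,$$ where $j$ runs over $1,\dots,N-1$ and, if $z\in\Omega$, also over $j=N$ with $\theta_{N+1}=\theta_1$ (a maximum over no indices is $0$). The vertex $z$ is singular if $\Gamma(z)=0$ and non-singular if $\Gamma(z)>0$. Let $\Theta_{\min}$ be the minimum of $\Theta(z)$ over the non-singular vertices; if there are none, $1/\Theta_{\min}$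 is read as $0$. For $k\ge1$, let $V_h^k$ be the space of vector fields that are continuous on $\overline\Omega$, vanish on $\partial\Omega$, and have components that are polynomials of degree at most $k$ on each triangle. Let $Q_h^{k-1}$ be the space of $q\in L^2(\Omega)$ with $\int_\Omega q\,dx=0$ such that $q|_T$ is a polynomial of degree at most $k-1$ for each $T\in\mathcal T_h$ and $\sum_{j=1}^N(-1)^{N-j}q|_{T_j}(z)=0$ for each singular vertex $z$. The triangulation is shape regular with parameter $\rho>0$ if each $T\in\mathcal T_h$ contains a ball of diameter at least $\rho\operatorname{diam}T$. **Lemma.** For every $\rho>0$ and every integer $k\ge1$ there is a constant $C_1>0$, depending only on $\rho$ and $k$, such that for every such triangulation that is shape regular with parameter $\rho$ and every $p\in Q_h^{k-1}$ there is a $v\in V_h^4$ with $$(\operatorname{div}v-p)|_T(z)=0\quad\text{for all } z\in\mathcal S_h \text{ and all } T\in\mathcal T_h \text{ with vertex } z,$$ $$\int_K\operatorname{div}v\,dx=0\quad\text{for all }K\in\mathcal T_h,$$ $$\|\nabla v\|_{L^2(\Omega)}\le C_1\Big(\frac1{\Theta_{\min}}+1\Big)\|p\|_{L^2(\Omega)}.$$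 -/

import Mathlib

open Set Filter Topology MeasureTheory Geometry

noncomputable section

namespace ScottVogelius

/-- The Euclidean plane. -/
abbrev Plane : Type := EuclideanSpace ℝ (Fin 2)

/-! ### Triangulations of polygonal domains

A face-to-face triangulation is a two-dimensional simplicial complex in the plane; a simplex is
given by the finite set of its vertices, and the closed simplex is the convex hull of that set. -/

/-- The (vertex sets of the) triangles of the mesh. -/
def triangles (K : SimplicialComplex ℝ Plane) : Set (Finset Plane) :=
  {s | s ∈ K.faces ∧ s.card = 3}

/-- The triangles that have `z` as a vertex. -/
def star (K : SimplicialComplex ℝ Plane) (z : Plane) : Set (Finset Plane) :=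
  {s | s ∈ triangles K ∧ z ∈ s}

/-- The closed triangle with vertex set `s`. -/
def closedTri (s : Finset Plane) : Set Plane := convexHull ℝ (s : Set Plane)

/-- The open triangle with vertex set `s`. -/
def openTri (s : Finset Plane) : Set Plane := interior (closedTri s)

/-- The domain `Ω` that is triangulated by `K`: the interior of the union of the closed
triangles. -/
def domain (K : SimplicialComplex ℝ Plane) : Set Plane := interior K.space

/-- The triangles `s` and `t` have a common edge. -/
def ShareEdge (K : SimplicialComplex ℝ Plane) (s t : Finset Plane) : Prop :=
  ∃ e ∈ K.faces, e.card = 2 ∧ e ⊆ s ∧ e ⊆ t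

/-- The triangle `s` has an edge with endpoint `z` that lies on the boundary of the domain. -/
def HasBoundaryEdge (K : SimplicialComplex ℝ Plane) (z : Plane) (s : Finset Plane) : Prop :=
  ∃ e ∈ K.faces, e.card = 2 ∧ z ∈ e ∧ e ⊆ s ∧
    convexHull ℝ (e : Set Plane) ⊆ frontier (domain K)

/-- `τ 1, …, τ N` is an enumeration, in consecutive order around the vertex `z`, of the triangles
that have `z` as a vertex: neighbours in the list share an edge, the last and the first triangle
share an edge if `z` is an interior vertex, and the first and the last triangle have a boundary edge
at `z` if `z` is a boundary vertex. -/
structure IsStarEnumeration (K : SimplicialComplex ℝ Plane) (z : Plane)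
    (N : ℕ) (τ : ℕ → Finset Plane) : Prop where
  bijOn : BijOn τ (Icc 1 N) (star K z)
  consecutive : ∀ j, 1 ≤ j → j < N → ShareEdge K (τ j) (τ (j + 1))
  interior_vertex : z ∈ domain K → ShareEdge K (τ N) (τ 1)
  boundary_vertex : z ∈ frontier (domain K) →
    HasBoundaryEdge K z (τ 1) ∧ HasBoundaryEdge K z (τ N)

/-- `K` is a (finite, face-to-face) triangulation of a polygonal domain. The last field expresses
that the boundary of the polygonal domain does not touch itself at a vertex: the triangles around
each vertex form one single closed (interior vertex) or open (boundary vertex) fan. -/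
structure IsTriangulation (K : SimplicialComplex ℝ Plane) : Prop where
  finite : K.faces.Finite
  pure : ∀ s ∈ K.faces, ∃ t ∈ triangles K, s ⊆ t
  connected : IsConnected (domain K)
  fan : ∀ z ∈ K.vertices, ∃ N τ, IsStarEnumeration K z N τ

/-- Shape regularity (non-degeneracy) with parameter `ρ`: every triangle `T` contains a ball whose
diameter is at least `ρ * diam T`. -/
def IsShapeRegular (K : SimplicialComplex ℝ Plane) (ρ : ℝ) : Prop :=
  ∀ s ∈ triangles K, ∃ (c : Plane) (r : ℝ),
    Metric.closedBall c r ⊆ closedTri s ∧ ρ * Metric.diam (closedTri s) ≤ 2 * r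

/-! ### Singular vertices -/

open Classical in
/-- The sums of the angles at `z` of two different triangles that share an edge
with endpoint `z`, that is, the numbers `θ_j + θ_{j+1}`
(including `θ_N + θ_1` if `z` is an interior vertex) for a consecutive enumeration of the triangles
around `z`. The set is empty if only one triangle has `z` as a vertex. -/
def angleSums (K : SimplicialComplex ℝ Plane) (z : Plane) : Set ℝ :=
  {σ | ∃ y a b : Plane, a ≠ b ∧ {z, y, a} ∈ triangles K ∧ {z, y, b} ∈ triangles K ∧
    σ = EuclideanGeometry.angle a z y + EuclideanGeometry.angle y z b}

/-- `Γ(z)`, the largest `|θ_j + θ_{j+1} - π|` (zero if there is no such pair). -/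
def Gam (K : SimplicialComplex ℝ Plane) (z : Plane) : ℝ :=
  sSup ((fun σ : ℝ => |σ - Real.pi|) '' angleSums K z)

/-- `Θ(z)`, the largest `|sin (θ_j + θ_{j+1})|` (zero if there is no such pair). -/
def Theta (K : SimplicialComplex ℝ Plane) (z : Plane) : ℝ :=
  sSup ((fun σ : ℝ => |Real.sin σ|) '' angleSums K z)

/-- The set of singular vertices. -/
def singularVertices (K : SimplicialComplex ℝ Plane) : Set Plane :=
  {z | z ∈ K.vertices ∧ Gam K z = 0}

/-- The set of non-singular vertices. -/
def nonsingularVertices (K : SimplicialComplex ℝ Plane) : Set Plane :=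
  {z | z ∈ K.vertices ∧ 0 < Gam K z}

/-- `1 / Θ_min`, where `Θ_min` is the smallest `Θ(z)` over the non-singular vertices; this is `0`
(the minimum of the empty set being `∞`) if there are no non-singular vertices. -/
def invThetaMin (K : SimplicialComplex ℝ Plane) : ℝ :=
  open Classical in
  if (nonsingularVertices K).Nonempty then 1 / sInf (Theta K '' nonsingularVertices K) else 0

/-! ### The finite element spaces -/

/-- On the set `S`, the function `f` is a polynomial of degree at most `m`. -/
def IsPolyOn (m : ℕ) (f : Plane → ℝ) (S : Set Plane) : Prop :=
  ∃ P : MvPolynomial (Fin 2) ℝ, P.totalDegree ≤ m ∧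
    ∀ x ∈ S, f x = MvPolynomial.eval (fun i => x i) P

/-- The value at a vertex `z` of the continuous extension to the closed triangle of the restriction
of `q` to the open triangle. -/
def vertexValue (q : Plane → ℝ) (s : Finset Plane) (z : Plane) : ℝ :=
  extendFrom (openTri s) q z

/-- The velocity space `V_h^k`: vector fields that are continuous on the closure of the domain,
vanish on its boundary and are, on each triangle, polynomials of degree at most `k`. -/
def velocitySpace (K : SimplicialComplex ℝ Plane) (k : ℕ) : Set (Plane → Plane) :=
  {v | ContinuousOn v (closure (domain K)) ∧
    (∀ x ∈ frontier (domain K), v x = 0) ∧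
    ∀ s ∈ triangles K, ∀ i : Fin 2, IsPolyOn k (fun x => v x i) (closedTri s)}

/-- The pressure space `Q_h^m`: square integrable functions with mean value zero that are
polynomials of degree at most `m` on each open triangle (the values on the edges, a null set, do not
matter) and whose alternating sum of vertex values is zero at each singular vertex. The condition
does not depend on the enumeration of the triangles around the vertex, since another admissible
enumeration changes at most the sign of the sum. -/
def pressureSpace (K : SimplicialComplex ℝ Plane) (m : ℕ) : Set (Plane → ℝ) :=
  {q | MemLp q 2 (volume.restrict (domain K)) ∧
    ∫ x in domain K, q x = 0 ∧
    (∀ s ∈ triangles K, IsPolyOn m q (openTri s)) ∧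
    ∀ z ∈ singularVertices K, ∀ N τ, IsStarEnumeration K z N τ →
      ∑ j ∈ Finset.Icc 1 N, (-1 : ℝ) ^ (N - j) * vertexValue q (τ j) z = 0}

/-- The partial derivative `∂_j v_i`. For piecewise polynomial fields it is meaningful inside the
triangles, hence almost everywhere, and it is then the weak derivative of a continuous field. -/
def partialDeriv (v : Plane → Plane) (j i : Fin 2) (x : Plane) : ℝ :=
  (fderiv ℝ v x (EuclideanSpace.single j 1)) i

/-- The divergence. -/
def divergence (v : Plane → Plane) (x : Plane) : ℝ := ∑ i : Fin 2, partialDeriv v i i x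

/-- The pointwise Euclidean (Frobenius) norm `|∇v|` of the gradient. -/
def gradNorm (v : Plane → Plane) (x : Plane) : ℝ :=
  Real.sqrt (∑ i : Fin 2, ∑ j : Fin 2, partialDeriv v j i x ^ 2)

/-- The norm of `L²(Ω)`. -/
def normL2 (K : SimplicialComplex ℝ Plane) (f : Plane → ℝ) : ENNReal :=
  eLpNorm f 2 (volume.restrict (domain K))

end ScottVogelius

end

namespace ScottVogelius

open scoped Classical

/-! The field is built vertex by vertex. For each vertex `z` there is a field supported on the
triangles at `z` whose divergence has the corner values of `p` at `z`, vanishes at all other corners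
and has mean zero on every triangle (`exists_vertexField`). The sum of these fields over all
vertices has the required divergence.

The building block is an edge bubble (`exists_edgeField`). For an edge `z y` and a constant vector
`w` it is (λ_z²λ_y − 5/2 λ_z²λ_y²) w on the two triangles at the edge and zero elsewhere. Its
gradient vanishes at every corner except `z`, where the divergence is ∇λ_y · w. The coefficient 5/2
makes the integral of the scalar factor over the edge vanish, so the divergence has mean zero on
both triangles for every `w`.

Two choices of `w` matter. The tangential vector `y - z` gives the value 1 at `z` on both triangles
(`exists_tangentialField`). For consecutive triangles around `z` these pairs span exactly the corner
values with zero alternating sum. At a singular vertex this is the condition on the pressure, so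
nothing else is needed. At a non-singular vertex some pair of adjacent angles has θ + θ' ≠ π. A
vector along the far edge of one triangle of the pair is then invisible there but not in the other
triangle, and this supplies the missing direction at the cost 1 / |sin (θ + θ')|
(`exists_singleField`).

Shape regularity makes the bound local: the number of triangles at a vertex is bounded
(`card_mul_sq_le_one`), their areas are comparable (`IsStarEnumeration.volume_le`), and corner
values are controlled by the L² norm on the triangle (`volume_mul_sq_polyFun_le`). Cauchy–Schwarz
and double counting add up the local bounds (`sum_mul_sq_sum_le`). -/

/-! ### Signed area and barycentric coordinates. -/

/-- Twice the signed area of the triangle with vertices `p`, `q`, `r`. -/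
def signedArea (p q r : Plane) : ℝ :=
  (q 0 - p 0) * (r 1 - p 1) - (q 1 - p 1) * (r 0 - p 0)

/-- The barycentric coordinate of `x` that belongs to the vertex `p` of the triangle `p q r`. -/
noncomputable def bary (p q r x : Plane) : ℝ := signedArea x q r / signedArea p q r

/-- The gradient of the barycentric coordinate `bary p q r`. -/
noncomputable def baryGrad (p q r : Plane) : Plane →L[ℝ] ℝ :=
  (signedArea p q r)⁻¹ • ((q 1 - r 1) • EuclideanSpace.proj (𝕜 := ℝ) (0 : Fin 2) +
    (r 0 - q 0) • EuclideanSpace.proj (𝕜 := ℝ) (1 : Fin 2))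

lemma baryGrad_apply (p q r w : Plane) :
    baryGrad p q r w = ((q 1 - r 1) * w 0 + (r 0 - q 0) * w 1) / signedArea p q r := by
  simp [baryGrad, div_eq_inv_mul]; ring

lemma signedArea_swap (p q r : Plane) : signedArea p r q = -signedArea p q r := by
  unfold signedArea; ring

lemma signedArea_swap_left (p q r : Plane) : signedArea q p r = -signedArea p q r := by
  unfold signedArea; ring

lemma signedArea_rotate (p q r : Plane) : signedArea q r p = signedArea p q r := by
  unfold signedArea; ring

lemma bary_self {p q r : Plane} (h : signedArea p q r ≠ 0) : bary p q r p = 1 := div_self h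

lemma bary_left (p q r : Plane) : bary p q r q = 0 := by
  simp [bary, signedArea]

lemma bary_right (p q r : Plane) : bary p q r r = 0 := by
  have : signedArea r q r = 0 := by unfold signedArea; ring
  simp [bary, this]

lemma bary_sub_bary (p q r x y : Plane) : bary p q r x - bary p q r y = baryGrad p q r (x - y) := by
  rw [baryGrad_apply, bary, bary, ← sub_div]
  congr 1
  simp only [signedArea, PiLp.sub_apply]; ring

lemma bary_eq (p q r x y : Plane) : bary p q r x = bary p q r y + baryGrad p q r (x - y) := by
  rw [← bary_sub_bary]; ring

lemma bary_sum {p q r : Plane} (h : signedArea p q r ≠ 0) (x : Plane) :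
    bary p q r x + bary q p r x + bary r p q x = 1 := by
  have h2 : signedArea r p q = signedArea p q r := by unfold signedArea; ring
  rw [bary, bary, bary, signedArea_swap_left p q r, h2]
  field_simp
  unfold signedArea; ring

lemma hasFDerivAt_bary (p q r x : Plane) : HasFDerivAt (bary p q r) (baryGrad p q r) x := by
  have h : bary p q r = fun y => bary p q r 0 + baryGrad p q r y := by
    ext y; rw [bary_eq p q r y 0, sub_zero]
  rw [h]
  exact (baryGrad p q r).hasFDerivAt.const_add _

lemma continuous_bary (p q r : Plane) : Continuous (bary p q r) :=
  continuous_iff_continuousAt.2 fun x => (hasFDerivAt_bary p q r x).continuousAt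

lemma bary_combination {p q r : Plane} (h : signedArea p q r ≠ 0) (x : Plane) :
    bary p q r x • p + bary q p r x • q + bary r p q x • r = x := by
  have h2 : signedArea r p q = signedArea p q r := by unfold signedArea; ring
  ext i
  simp only [PiLp.add_apply, PiLp.smul_apply, smul_eq_mul]
  rw [bary, bary, bary, signedArea_swap_left p q r, h2]
  field_simp
  unfold signedArea
  fin_cases i <;> simp <;> ring

lemma bary_convexCombination (p q r x y : Plane) (s t : ℝ) (hst : s + t = 1) :
    bary p q r (s • x + t • y) = s * bary p q r x + t * bary p q r y := by
  obtain rfl : t = 1 - s := by linarith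
  have h1 : s • x + (1 - s) • y - y = s • (x - y) := by module
  rw [bary_eq p q r _ y, bary_eq p q r x y, h1, map_smul, smul_eq_mul]
  ring

lemma convex_bary_nonneg (p q r : Plane) : Convex ℝ {x | 0 ≤ bary p q r x} := by
  intro x hx y hy s t hs ht hst
  simp only [mem_ofPred_eq] at *
  rw [bary_convexCombination _ _ _ _ _ _ _ hst]
  positivity

lemma convex_bary_eq_zero (p q r : Plane) : Convex ℝ {x | bary p q r x = 0} := by
  intro x hx y hy s t hs ht hst
  simp only [mem_ofPred_eq] at *
  rw [bary_convexCombination _ _ _ _ _ _ _ hst, hx, hy]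
  ring

lemma mem_closedTri_iff {p q r : Plane} (h : signedArea p q r ≠ 0) (x : Plane) :
    x ∈ closedTri {p, q, r} ↔ 0 ≤ bary p q r x ∧ 0 ≤ bary q p r x ∧ 0 ≤ bary r p q x := by
  have hq : signedArea q p r ≠ 0 := by rw [signedArea_swap_left]; simpa
  have hr : signedArea r p q ≠ 0 := by rwa [← signedArea_rotate r p q]
  constructor
  · intro hx
    have key : ∀ u v w : Plane, 0 ≤ bary u v w p → 0 ≤ bary u v w q → 0 ≤ bary u v w r →
        0 ≤ bary u v w x := by
      intro u v w h1 h2 h3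
      refine convexHull_min ?_ (convex_bary_nonneg u v w) hx
      intro y hy
      simp only [Finset.coe_insert, Finset.coe_singleton, mem_insert_iff, mem_singleton_iff] at hy
      rcases hy with rfl | rfl | rfl <;> assumption
    refine ⟨key _ _ _ ?_ ?_ ?_, key _ _ _ ?_ ?_ ?_, key _ _ _ ?_ ?_ ?_⟩ <;>
      simp [bary_self, bary_left, bary_right, h, hq, hr]
  · rintro ⟨h1, h2, h3⟩
    rw [← bary_combination h x]
    have hc : Convex ℝ (closedTri {p, q, r}) := convex_convexHull ℝ _
    have hp : ∀ y ∈ ({p, q, r} : Finset Plane), y ∈ closedTri {p, q, r} :=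
      fun y hy => subset_convexHull ℝ _ hy
    exact hc.sum_mem (t := Finset.univ) (w := ![bary p q r x, bary q p r x, bary r p q x])
      (z := ![p, q, r]) (by intro i _; fin_cases i <;> simpa)
      (by simpa [Fin.sum_univ_three] using bary_sum h x)
      (by intro i _; fin_cases i <;> exact hp _ (by simp)) |> fun h => by
        simpa [Fin.sum_univ_three] using h

/-! ### Triangles of the mesh: nondegeneracy, interiors and incidences. -/

lemma signedArea_ne_zero {K : SimplicialComplex ℝ Plane} {p q r : Plane}
    (h : {p, q, r} ∈ triangles K) : signedArea p q r ≠ 0 := by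
  obtain ⟨hf, hc⟩ := h
  obtain ⟨hpq, hpr, hqr⟩ : p ≠ q ∧ p ≠ r ∧ q ≠ r := by
    refine ⟨?_, ?_, ?_⟩ <;> rintro rfl
    · have := Finset.card_le_two (a := p) (b := r)
      simp at hc; omega
    · have := Finset.card_le_two (a := q) (b := p)
      rw [show ({p, q, p} : Finset Plane) = {q, p} by ext; simp] at hc; omega
    · have := Finset.card_le_two (a := p) (b := q)
      simp at hc; omega
  have hi := K.indep hf
  let f : Fin 3 ↪ ({p, q, r} : Finset Plane) :=
    ⟨![⟨p, by simp⟩, ⟨q, by simp⟩, ⟨r, by simp⟩], by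
      intro i j hij
      fin_cases i <;> fin_cases j <;> simp_all⟩
  have h3 := hi.comp_embedding f
  have h4 : ((fun x : ({p, q, r} : Finset Plane) => (x : Plane)) ∘ f) = ![p, q, r] := by
    ext i j; fin_cases i <;> rfl
  rw [h4, affineIndependent_iff_not_collinear_set] at h3
  intro h0
  apply h3
  rw [collinear_iff_of_mem (p₀ := p) (by simp)]
  refine ⟨q - p, ?_⟩
  intro y hy
  simp only [mem_insert_iff, mem_singleton_iff] at hy
  rcases hy with rfl | rfl | rfl
  · exact ⟨0, by simp⟩
  · exact ⟨1, by simp⟩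
  · unfold signedArea at h0
    -- The parameter of the third vertex on the line through `p` and `q` is read off in a coordinate
    -- in which `p` and `q` differ.
    by_cases h1 : q 0 - p 0 = 0
    · have h2 : q 1 - p 1 ≠ 0 := by
        intro h2; apply hpq; ext i; fin_cases i <;> simp <;> linarith
      refine ⟨(y 1 - p 1) / (q 1 - p 1), ?_⟩
      ext i
      fin_cases i
      · have : y 0 - p 0 = 0 := by
          rw [h1, zero_mul, zero_sub, neg_eq_zero] at h0
          exact (mul_eq_zero.1 h0).resolve_left h2
        simp [h1]; linarith
      · simp; field_simp; ring
    · refine ⟨(y 0 - p 0) / (q 0 - p 0), ?_⟩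
      ext i
      fin_cases i
      · simp; field_simp; ring
      · simp; field_simp; linarith

lemma card_triple {K : SimplicialComplex ℝ Plane} {p q r : Plane}
    (h : {p, q, r} ∈ triangles K) : p ≠ q ∧ p ≠ r ∧ q ≠ r := by
  have h0 := signedArea_ne_zero h
  refine ⟨?_, ?_, ?_⟩ <;> rintro rfl <;> apply h0 <;> unfold signedArea <;> ring

/-- A triangle with vertex `z` has the form `z y a`. -/
lemma exists_eq_triple {K : SimplicialComplex ℝ Plane} {s : Finset Plane} (hs : s ∈ triangles K)
    {z : Plane} (hz : z ∈ s) : ∃ y a, s = {z, y, a} := by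
  have h2 : (s.erase z).card = 2 := by rw [Finset.card_erase_of_mem hz, hs.2]
  obtain ⟨y, a, -, h⟩ := Finset.card_eq_two.1 h2
  exact ⟨y, a, by rw [← Finset.insert_erase hz, h]⟩

/-- A triangle with the edge `z y` has the form `z y a`. -/
lemma exists_eq_triple_of_edge {K : SimplicialComplex ℝ Plane} {s : Finset Plane}
    (hs : s ∈ triangles K) {z y : Plane} (hz : z ∈ s) (hy : y ∈ s) (hzy : y ≠ z) :
    ∃ a, s = {z, y, a} := by
  have h2 : ((s.erase z).erase y).card = 1 := by
    rw [Finset.card_erase_of_mem (by simp [hy, hzy]), Finset.card_erase_of_mem hz, hs.2]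
  obtain ⟨a, h⟩ := Finset.card_eq_one.1 h2
  refine ⟨a, ?_⟩
  rw [← Finset.insert_erase hz, ← Finset.insert_erase (s := s.erase z) (a := y) (by simp [hy, hzy]),
    h]

lemma triple_rotate (p q r : Plane) : ({q, p, r} : Finset Plane) = {p, q, r} :=
  Finset.insert_comm _ _ _

lemma triple_swap (p q r : Plane) : ({p, r, q} : Finset Plane) = {p, q, r} := by
  rw [Finset.pair_comm]

/-- In the interior of a triangle the barycentric coordinates are positive. -/
lemma bary_pos_of_mem_openTri {p q r : Plane} (h : signedArea p q r ≠ 0) {x : Plane}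
    (hx : x ∈ openTri {p, q, r}) : 0 < bary p q r x := by
  -- Pushing `x` slightly away from `p` stays in the triangle and changes the coordinate λ into (1 +
  -- ε)λ − ε, which must still be nonnegative.
  have hc : Tendsto (fun ε : ℝ => x + ε • (x - p)) (𝓝[>] 0) (𝓝 x) := by
    have : Continuous fun ε : ℝ => x + ε • (x - p) := by fun_prop
    have h2 := (this.tendsto 0).mono_left (nhdsWithin_le_nhds (s := Ioi 0))
    simpa using h2
  obtain ⟨ε, h1, h2⟩ := ((hc.eventually (isOpen_interior.mem_nhds hx)).and
    self_mem_nhdsWithin).exists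
  have h3 := ((mem_closedTri_iff h _).1 (interior_subset h1)).1
  rw [bary_eq p q r _ x, add_sub_cancel_left, map_smul, ← bary_sub_bary, bary_self h,
    smul_eq_mul] at h3
  have h4 : (0 : ℝ) < ε := h2
  nlinarith

lemma mem_openTri_iff {p q r : Plane} (h : signedArea p q r ≠ 0) (x : Plane) :
    x ∈ openTri {p, q, r} ↔ 0 < bary p q r x ∧ 0 < bary q p r x ∧ 0 < bary r p q x := by
  have hq : signedArea q p r ≠ 0 := by rw [signedArea_swap_left]; simpa
  have hr : signedArea r p q ≠ 0 := by rwa [← signedArea_rotate r p q]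
  constructor
  · intro hx
    refine ⟨bary_pos_of_mem_openTri h hx, bary_pos_of_mem_openTri hq ?_,
      bary_pos_of_mem_openTri hr ?_⟩
    · rwa [triple_rotate]
    · rwa [triple_rotate, triple_swap]
  · intro hx
    have ho : IsOpen {y | 0 < bary p q r y ∧ 0 < bary q p r y ∧ 0 < bary r p q y} :=
      (isOpen_lt continuous_const (continuous_bary _ _ _)).inter
        ((isOpen_lt continuous_const (continuous_bary _ _ _)).inter
        (isOpen_lt continuous_const (continuous_bary _ _ _)))
    refine interior_maximal ?_ ho hx
    rintro y ⟨h1, h2, h3⟩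
    exact (mem_closedTri_iff h y).2 ⟨h1.le, h2.le, h3.le⟩

/-- A point of two triangles with positive coordinate at the vertex `p` of the first one: then `p`
is a vertex of the second one, too. -/
lemma mem_of_bary_pos {K : SimplicialComplex ℝ Plane} {p q r : Plane} {t : Finset Plane}
    (hs : {p, q, r} ∈ triangles K) (ht : t ∈ triangles K) {x : Plane}
    (hxs : x ∈ closedTri {p, q, r}) (hxt : x ∈ closedTri t) (hpos : 0 < bary p q r x) : p ∈ t := by
  by_contra hp
  -- In a face-to-face mesh, `x` lies in the hull of the common vertices. If `p` is not one of them,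
  -- its coordinate vanishes on that hull.
  have h1 := K.inter_subset_convexHull hs.1 ht.1 ⟨hxs, hxt⟩
  have h2 : bary p q r x = 0 := by
    refine convexHull_min ?_ (convex_bary_eq_zero p q r) h1
    rintro y ⟨hy1, hy2⟩
    simp only [Finset.coe_insert, Finset.coe_singleton, mem_insert_iff, mem_singleton_iff] at hy1
    rcases hy1 with rfl | rfl | rfl
    · exact absurd hy2 hp
    · exact bary_left _ _ _
    · exact bary_right _ _ _
  exact hpos.ne' h2

lemma openTri_nonempty {K : SimplicialComplex ℝ Plane} {s : Finset Plane} (hs : s ∈ triangles K) :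
    (openTri s).Nonempty := by
  obtain ⟨z, hz⟩ := Finset.card_pos.1 (by rw [hs.2]; norm_num : 0 < s.card)
  obtain ⟨y, a, rfl⟩ := exists_eq_triple hs hz
  have h := signedArea_ne_zero hs
  have hq : signedArea y z a ≠ 0 := by rw [signedArea_swap_left]; simpa
  have hr : signedArea a z y ≠ 0 := by rwa [← signedArea_rotate a z y]
  refine ⟨(1 / 3 : ℝ) • z + (2 / 3 : ℝ) • ((1 / 2 : ℝ) • y + (1 / 2 : ℝ) • a), ?_⟩
  rw [mem_openTri_iff h]
  refine ⟨?_, ?_, ?_⟩ <;> rw [bary_convexCombination _ _ _ _ _ _ _ (by norm_num),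
      bary_convexCombination _ _ _ _ _ _ _ (by norm_num)] <;>
    simp [bary_self, bary_left, bary_right, h, hq, hr]

lemma disjoint_openTri {K : SimplicialComplex ℝ Plane} {s t : Finset Plane}
    (hs : s ∈ triangles K) (ht : t ∈ triangles K) (hst : s ≠ t) :
    Disjoint (openTri s) (openTri t) := by
  rw [Set.disjoint_left]
  intro x hxs hxt
  apply hst
  apply Finset.eq_of_subset_of_card_le _ (by rw [hs.2, ht.2])
  intro p hp
  obtain ⟨q, r, rfl⟩ := exists_eq_triple hs hp
  exact mem_of_bary_pos hs ht (interior_subset hxs) (interior_subset hxt)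
    (bary_pos_of_mem_openTri (signedArea_ne_zero hs) hxs)

/-- The triangles on the two sides of an edge lie on different sides of it. -/
lemma signedArea_mul_neg {K : SimplicialComplex ℝ Plane} {z y a b : Plane}
    (hs : {z, y, a} ∈ triangles K) (ht : {z, y, b} ∈ triangles K) (hab : a ≠ b) :
    signedArea z y a * signedArea z y b < 0 := by
  have h := signedArea_ne_zero hs
  have h' := signedArea_ne_zero ht
  by_contra hcon
  have hpos : 0 < signedArea z y a * signedArea z y b :=
    lt_of_le_of_ne (not_lt.1 hcon) (mul_ne_zero h h').symm
  have hy : signedArea y z b ≠ 0 := by rw [signedArea_swap_left]; simpa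
  have hb : signedArea b z y ≠ 0 := by rwa [← signedArea_rotate b z y]
  have ha : signedArea a z y ≠ 0 := by rwa [← signedArea_rotate a z y]
  have hys : signedArea y z a ≠ 0 := by rw [signedArea_swap_left]; simpa
  -- If `a` and `b` were on the same side, a small move from the edge midpoint `m` towards `a` would
  -- stay in both triangles. The coordinate at `a` is positive there, so `a` would be a vertex of
  -- the second triangle.
  let m : Plane := (1 / 2 : ℝ) • z + (1 / 2 : ℝ) • y
  have hc : Tendsto (fun ε : ℝ => (1 - ε) • m + ε • a) (𝓝[>] 0) (𝓝 m) := by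
    have : Continuous fun ε : ℝ => (1 - ε) • m + ε • a := by fun_prop
    have h2 := (this.tendsto 0).mono_left (nhdsWithin_le_nhds (s := Ioi 0))
    simpa using h2
  have m1 : 0 < bary z y b m := by
    rw [bary_convexCombination _ _ _ _ _ _ _ (by norm_num)]
    simp [bary_self, bary_left, h']
  have m2 : 0 < bary y z b m := by
    rw [bary_convexCombination _ _ _ _ _ _ _ (by norm_num)]
    simp [bary_self, bary_left, hy]
  have e1 := hc.eventually (((continuous_bary z y b).tendsto m).eventually (lt_mem_nhds m1))
  have e2 := hc.eventually (((continuous_bary y z b).tendsto m).eventually (lt_mem_nhds m2))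
  have e3 : ∀ᶠ ε : ℝ in 𝓝[>] 0, ε ∈ Ioo (0 : ℝ) 1 := Ioo_mem_nhdsGT (by norm_num)
  obtain ⟨ε, ⟨⟨h1, h2⟩, h3⟩⟩ := ((e1.and e2).and e3).exists
  have hmem : (1 - ε) • m + ε • a ∈ closedTri {z, y, b} := by
    rw [mem_closedTri_iff h']
    refine ⟨h1.le, h2.le, ?_⟩
    rw [bary_convexCombination _ _ _ _ _ _ _ (by ring),
      bary_convexCombination _ _ _ _ _ _ _ (by norm_num), bary_left, bary_right]
    have : 0 ≤ bary b z y a := by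
      rw [bary, signedArea_rotate z y a |>.symm.trans (signedArea_rotate y a z).symm |>.symm,
        signedArea_rotate z y b |>.symm.trans (signedArea_rotate y b z).symm |>.symm]
      exact (div_pos_iff.2 (mul_pos_iff.1 hpos)).le
    simpa using mul_nonneg h3.1.le this
  have hmem' : (1 - ε) • m + ε • a ∈ closedTri {z, y, a} := by
    have hm : m ∈ closedTri {z, y, a} :=
      convex_convexHull ℝ _ (subset_convexHull ℝ _ (by simp)) (subset_convexHull ℝ _ (by simp))
        (by norm_num) (by norm_num) (by norm_num)
    exact convex_convexHull ℝ _ hm (subset_convexHull ℝ _ (by simp))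
        (by linarith [h3.2]) h3.1.le (by ring)
  have hap : 0 < bary a z y ((1 - ε) • m + ε • a) := by
    rw [bary_convexCombination _ _ _ _ _ _ _ (by ring),
      bary_convexCombination _ _ _ _ _ _ _ (by norm_num), bary_left, bary_right, bary_self ha]
    simpa using h3.1
  have hs' : ({a, z, y} : Finset Plane) = {z, y, a} := by rw [triple_rotate, triple_swap]
  have : a ∈ ({z, y, b} : Finset Plane) :=
    mem_of_bary_pos (hs' ▸ hs) ht (hs' ▸ hmem') hmem hap
  obtain ⟨-, n1, n2⟩ := card_triple hs
  simp only [Finset.mem_insert, Finset.mem_singleton] at this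
  rcases this with h | h | h
  · exact n1 h.symm
  · exact n2 h.symm
  · exact hab h

/-- An edge belongs to at most two triangles. -/
lemma eq_or_eq_of_edge_subset {K : SimplicialComplex ℝ Plane} {z y a b : Plane} {u : Finset Plane}
    (hs : {z, y, a} ∈ triangles K) (ht : {z, y, b} ∈ triangles K) (hab : a ≠ b)
    (hu : u ∈ triangles K) (hz : z ∈ u) (hy : y ∈ u) : u = {z, y, a} ∨ u = {z, y, b} := by
  obtain ⟨c, rfl⟩ := exists_eq_triple_of_edge hu hz hy (card_triple hs).1.symm
  by_contra! hcon
  have hca : c ≠ a := by rintro rfl; exact hcon.1 rfl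
  have hcb : c ≠ b := by rintro rfl; exact hcon.2 rfl
  -- Three triangles at one edge would lie on pairwise opposite sides of a line.
  have h1 := signedArea_mul_neg hs ht hab
  have h2 := signedArea_mul_neg hu hs hca
  have h3 := signedArea_mul_neg hu ht hcb
  have h4 := mul_pos_of_neg_of_neg h2 h3
  nlinarith [mul_neg_of_pos_of_neg (sq_pos_of_ne_zero (signedArea_ne_zero hu)) h1]

/-! ### Piecewise polynomials -/

lemma IsPolyOn.add {m : ℕ} {f g : Plane → ℝ} {S : Set Plane} (hf : IsPolyOn m f S)
    (hg : IsPolyOn m g S) : IsPolyOn m (fun x => f x + g x) S := by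
  obtain ⟨P, hP, hf⟩ := hf
  obtain ⟨Q, hQ, hg⟩ := hg
  exact ⟨P + Q, (MvPolynomial.totalDegree_add P Q).trans (max_le hP hQ),
    fun x hx => by simp [hf x hx, hg x hx]⟩

lemma IsPolyOn.mul {m n : ℕ} {f g : Plane → ℝ} {S : Set Plane} (hf : IsPolyOn m f S)
    (hg : IsPolyOn n g S) : IsPolyOn (m + n) (fun x => f x * g x) S := by
  obtain ⟨P, hP, hf⟩ := hf
  obtain ⟨Q, hQ, hg⟩ := hg
  exact ⟨P * Q, (MvPolynomial.totalDegree_mul P Q).trans (add_le_add hP hQ),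
    fun x hx => by simp [hf x hx, hg x hx]⟩

lemma isPolyOn_const (c : ℝ) (S : Set Plane) : IsPolyOn 0 (fun _ => c) S :=
  ⟨MvPolynomial.C c, by simp, fun x _ => by simp⟩

lemma IsPolyOn.mono {m n : ℕ} {f : Plane → ℝ} {S : Set Plane} (hf : IsPolyOn m f S)
    (hmn : m ≤ n) : IsPolyOn n f S := by
  obtain ⟨P, hP, hf⟩ := hf
  exact ⟨P, hP.trans hmn, hf⟩

lemma IsPolyOn.congr {m : ℕ} {f g : Plane → ℝ} {S : Set Plane} (hf : IsPolyOn m f S)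
    (h : ∀ x ∈ S, g x = f x) : IsPolyOn m g S := by
  obtain ⟨P, hP, hf⟩ := hf
  exact ⟨P, hP, fun x hx => (h x hx).trans (hf x hx)⟩

lemma isPolyOn_coord (i : Fin 2) (S : Set Plane) : IsPolyOn 1 (fun x => x i) S :=
  ⟨MvPolynomial.X i, by simp, fun x _ => by simp⟩

lemma isPolyOn_bary (p q r : Plane) (S : Set Plane) : IsPolyOn 1 (bary p q r) S := by
  have h0 := (isPolyOn_const (baryGrad p q r (EuclideanSpace.single 0 1)) S).mul
    (isPolyOn_coord 0 S)
  have h1 := (isPolyOn_const (baryGrad p q r (EuclideanSpace.single 1 1)) S).mul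
    (isPolyOn_coord 1 S)
  refine (((isPolyOn_const (bary p q r 0) S).mono zero_le_one).add (h0.add h1)).congr ?_
  intro x _
  rw [bary_eq p q r x 0, sub_zero]
  simp only [baryGrad_apply]
  simp
  ring

/-! ### Data of a field on one triangle -/

/-- On the triangle `u`, the field `v` is a polynomial of degree at most four, its divergence has
mean value zero and the values `d σ` at the vertices `σ`, and its partial derivatives are bounded
by `B`. -/
structure HasTriData (u : Finset Plane) (v : Plane → Plane) (d : Plane → ℝ) (B : ℝ) : Prop where
  poly : ∀ i : Fin 2, IsPolyOn 4 (fun x => v x i) (closedTri u)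
  diff : ∀ x ∈ openTri u, DifferentiableAt ℝ v x
  integrable : IntegrableOn (divergence v) (openTri u)
  mean : ∫ x in openTri u, divergence v x = 0
  lim : ∀ σ ∈ u, Tendsto (divergence v) (𝓝[openTri u] σ) (𝓝 (d σ))
  bound : ∀ x ∈ openTri u, ∀ i j, |partialDeriv v j i x| ≤ B

lemma isOpen_openTri (u : Finset Plane) : IsOpen (openTri u) := isOpen_interior

lemma measurableSet_openTri (u : Finset Plane) : MeasurableSet (openTri u) :=
  (isOpen_openTri u).measurableSet

lemma partialDeriv_congr {u : Finset Plane} {v v' : Plane → Plane}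
    (h : EqOn v v' (closedTri u)) {x : Plane} (hx : x ∈ openTri u) (j i : Fin 2) :
    partialDeriv v j i x = partialDeriv v' j i x := by
  have : v =ᶠ[𝓝 x] v' := by
    filter_upwards [(isOpen_openTri u).mem_nhds hx] with y hy
    exact h (interior_subset hy)
  rw [partialDeriv, partialDeriv, this.fderiv_eq]

lemma divergence_congr {u : Finset Plane} {v v' : Plane → Plane}
    (h : EqOn v v' (closedTri u)) : EqOn (divergence v) (divergence v') (openTri u) := by
  intro x hx
  simp only [divergence, partialDeriv_congr h hx]

lemma HasTriData.congr {u : Finset Plane} {v v' : Plane → Plane} {d : Plane → ℝ} {B : ℝ}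
    (hv : HasTriData u v d B) (h : EqOn v' v (closedTri u)) : HasTriData u v' d B where
  poly i := (hv.poly i).congr fun x hx => by rw [h hx]
  diff x hx := by
    refine (hv.diff x hx).congr_of_eventuallyEq ?_
    filter_upwards [(isOpen_openTri u).mem_nhds hx] with y hy
    exact h (interior_subset hy)
  integrable := hv.integrable.congr_fun (divergence_congr h).symm (measurableSet_openTri u)
  mean := by
    rw [setIntegral_congr_fun (measurableSet_openTri u) (divergence_congr h), hv.mean]
  lim σ hσ := (hv.lim σ hσ).congr' <| by
    filter_upwards [self_mem_nhdsWithin] with y hy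
    exact (divergence_congr h hy).symm
  bound x hx i j := by
    rw [partialDeriv_congr h hx]; exact hv.bound x hx i j

lemma HasTriData.mono {u : Finset Plane} {v : Plane → Plane} {d d' : Plane → ℝ} {B B' : ℝ}
    (hv : HasTriData u v d B) (hd : ∀ σ ∈ u, d σ = d' σ) (hB : B ≤ B') :
    HasTriData u v d' B' :=
  { hv with
    lim := fun σ hσ => hd σ hσ ▸ hv.lim σ hσ
    bound := fun x hx i j => (hv.bound x hx i j).trans hB }

lemma partialDeriv_add {v v' : Plane → Plane} {x : Plane} (h : DifferentiableAt ℝ v x)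
    (h' : DifferentiableAt ℝ v' x) (j i : Fin 2) :
    partialDeriv (v + v') j i x = partialDeriv v j i x + partialDeriv v' j i x := by
  simp [partialDeriv, fderiv_add h h']

lemma partialDeriv_smul {v : Plane → Plane} {x : Plane} (h : DifferentiableAt ℝ v x) (c : ℝ)
    (j i : Fin 2) : partialDeriv (c • v) j i x = c * partialDeriv v j i x := by
  simp [partialDeriv, fderiv_const_smul h]

lemma HasTriData.add {u : Finset Plane} {v v' : Plane → Plane} {d d' : Plane → ℝ} {B B' : ℝ}
    (hv : HasTriData u v d B) (hv' : HasTriData u v' d' B') :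
    HasTriData u (v + v') (fun σ => d σ + d' σ) (B + B') := by
  have key : EqOn (divergence (v + v')) (fun x => divergence v x + divergence v' x)
      (openTri u) := by
    intro x hx
    simp only [divergence, partialDeriv_add (hv.diff x hx) (hv'.diff x hx),
      Finset.sum_add_distrib]
  refine ⟨fun i => ((hv.poly i).add (hv'.poly i)).congr fun x _ => by simp,
    fun x hx => (hv.diff x hx).add (hv'.diff x hx), ?_, ?_, ?_, ?_⟩
  · exact (hv.integrable.add hv'.integrable).congr_fun key.symm (measurableSet_openTri u)
  · rw [setIntegral_congr_fun (measurableSet_openTri u) key,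
      integral_add hv.integrable hv'.integrable, hv.mean, hv'.mean, add_zero]
  · intro σ hσ
    refine ((hv.lim σ hσ).add (hv'.lim σ hσ)).congr' ?_
    filter_upwards [self_mem_nhdsWithin] with y hy
    exact (key hy).symm
  · intro x hx i j
    rw [partialDeriv_add (hv.diff x hx) (hv'.diff x hx)]
    exact (abs_add_le _ _).trans (add_le_add (hv.bound x hx i j) (hv'.bound x hx i j))

lemma HasTriData.smul {u : Finset Plane} {v : Plane → Plane} {d : Plane → ℝ} {B : ℝ}
    (hv : HasTriData u v d B) (c : ℝ) :
    HasTriData u (c • v) (fun σ => c * d σ) (|c| * B) := by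
  have key : EqOn (divergence (c • v)) (fun x => c * divergence v x) (openTri u) := by
    intro x hx
    simp only [divergence, partialDeriv_smul (hv.diff x hx), Finset.mul_sum]
  refine ⟨fun i => (((isPolyOn_const c _).mul (hv.poly i)).mono (by norm_num)).congr
    fun x _ => by simp, fun x hx => (hv.diff x hx).const_smul c, ?_, ?_, ?_, ?_⟩
  · exact IntegrableOn.congr_fun (hv.integrable.const_mul c) key.symm (measurableSet_openTri u)
  · rw [setIntegral_congr_fun (measurableSet_openTri u) key, integral_const_mul, hv.mean, mul_zero]
  · intro σ hσ
    refine ((hv.lim σ hσ).const_mul c).congr' ?_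
    filter_upwards [self_mem_nhdsWithin] with y hy
    exact (key hy).symm
  · intro x hx i j
    rw [partialDeriv_smul (hv.diff x hx), abs_mul]
    exact mul_le_mul_of_nonneg_left (hv.bound x hx i j) (abs_nonneg c)

lemma partialDeriv_zero (x : Plane) (j i : Fin 2) : partialDeriv 0 j i x = 0 := by
  simp [partialDeriv]

lemma divergence_zero : divergence 0 = 0 := by
  ext x; simp [divergence, partialDeriv_zero]

lemma hasTriData_zero (u : Finset Plane) : HasTriData u 0 (fun _ => 0) 0 where
  poly i := ((isPolyOn_const 0 _).mono (by norm_num)).congr fun x _ => by simp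
  diff x _ := differentiableAt_const 0
  integrable := by rw [divergence_zero]; exact integrableOn_zero
  mean := by simp [divergence_zero]
  lim σ _ := by rw [divergence_zero]; exact tendsto_const_nhds
  bound x _ i j := by simp [partialDeriv_zero]

/-! ### Integrals in barycentric coordinates -/

/-- The linear part of the map to the barycentric coordinates of two vertices. -/
noncomputable def baryEquiv {p q r : Plane} (h : signedArea p q r ≠ 0) : Plane ≃L[ℝ] ℝ × ℝ :=
  ContinuousLinearEquiv.equivOfInverse ((baryGrad p q r).prod (baryGrad q p r))
    ((ContinuousLinearMap.fst ℝ ℝ ℝ).smulRight (p - r) +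
      (ContinuousLinearMap.snd ℝ ℝ ℝ).smulRight (q - r))
    (by
      intro x
      have hD : signedArea q p r = -signedArea p q r := signedArea_swap_left p q r
      ext i
      simp only [ContinuousLinearMap.prod_apply, add_apply,
        ContinuousLinearMap.smulRight_apply, ContinuousLinearMap.coe_fst',
        ContinuousLinearMap.coe_snd', baryGrad_apply, hD, PiLp.add_apply, PiLp.smul_apply,
        PiLp.sub_apply, smul_eq_mul]
      field_simp
      unfold signedArea
      fin_cases i <;> simp <;> ring)
    (by
      rintro ⟨s, t⟩
      have hD : signedArea q p r = -signedArea p q r := signedArea_swap_left p q r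
      simp only [ContinuousLinearMap.prod_apply, add_apply,
        ContinuousLinearMap.smulRight_apply, ContinuousLinearMap.coe_fst',
        ContinuousLinearMap.coe_snd', baryGrad_apply, hD, PiLp.add_apply, PiLp.smul_apply,
        PiLp.sub_apply, smul_eq_mul, Prod.mk.injEq]
      constructor <;> field_simp <;> unfold signedArea <;> ring)

lemma baryEquiv_apply {p q r : Plane} (h : signedArea p q r ≠ 0) (x : Plane) :
    baryEquiv h (x - r) = (bary p q r x, bary q p r x) := by
  change (baryGrad p q r (x - r), baryGrad q p r (x - r)) = _
  rw [← bary_sub_bary, ← bary_sub_bary, bary_right, bary_right, sub_zero, sub_zero]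

/-- The open reference triangle. -/
def refTri : Set (ℝ × ℝ) := {y | 0 < y.1 ∧ 0 < y.2 ∧ y.1 + y.2 < 1}

lemma measurableSet_refTri : MeasurableSet refTri := by
  refine (measurableSet_lt measurable_const measurable_fst).inter
    ((measurableSet_lt measurable_const measurable_snd).inter
    (measurableSet_lt (measurable_fst.add measurable_snd) measurable_const))

/-- The affine map to barycentric coordinates carries Lebesgue measure to a constant multiple of
itself, by uniqueness of Haar measure. Only vanishing integrals are transferred, so the constant
plays no role. -/
lemma integral_openTri {p q r : Plane} (h : signedArea p q r ≠ 0) (G : ℝ × ℝ → ℝ)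
    (hG : ∫ y in refTri, G y = 0) :
    ∫ x in openTri {p, q, r}, G (bary p q r x, bary q p r x) = 0 := by
  let M := baryEquiv h
  have hM : MeasurableEmbedding fun x : Plane => M (x - r) :=
    M.toHomeomorph.measurableEmbedding.comp (Homeomorph.subRight r).measurableEmbedding
  have hpre : (fun x : Plane => M (x - r)) ⁻¹' refTri = openTri {p, q, r} := by
    ext x
    rw [mem_openTri_iff h, mem_preimage, baryEquiv_apply h]
    have := bary_sum h x
    simp only [refTri, mem_ofPred_eq]
    refine and_congr_right fun _ => and_congr_right fun _ => ?_
    constructor <;> intro <;> linarith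
  have hmap : ∃ c : NNReal, Measure.map (fun x : Plane => M (x - r)) volume =
      c • (volume : Measure (ℝ × ℝ)) := by
    have h1 : Measure.map (fun x : Plane => M (x - r)) volume =
        Measure.map M (volume : Measure Plane) := by
      have h0 := Measure.map_map (μ := volume) M.continuous.measurable
        (measurable_id.sub_const r)
      simp only [id] at h0
      rw [(measurePreserving_sub_right volume r).map_eq] at h0
      exact h0.symm
    have h2 : (Measure.map M (volume : Measure Plane)).IsAddHaarMeasure :=
      M.isAddHaarMeasure_map volume
    exact ⟨_, h1.trans (Measure.isAddLeftInvariant_eq_smul _ volume)⟩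
  obtain ⟨c, hc⟩ := hmap
  have h3 := hM.setIntegral_map (μ := volume) G refTri
  rw [hpre, hc, Measure.restrict_smul, integral_smul_nnreal_measure, hG, smul_zero] at h3
  rw [h3]
  simp only [baryEquiv_apply, M]

lemma integral_refTri {G : ℝ × ℝ → ℝ} (hG : Continuous G) :
    ∫ y in refTri, G y = ∫ s in (0 : ℝ)..1, ∫ t in (0 : ℝ)..(1 - s), G (s, t) := by
  have hint : IntegrableOn G refTri := by
    refine (hG.continuousOn.integrableOn_compact (isCompact_Icc (a := ((0 : ℝ), (0 : ℝ)))
      (b := (1, 1)))).mono_set ?_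
    rintro ⟨s, t⟩ ⟨h1, h2, h3⟩
    simp only at h1 h2 h3
    exact ⟨⟨h1.le, h2.le⟩, ⟨by simp; linarith, by simp; linarith⟩⟩
  rw [← integral_indicator measurableSet_refTri]
  rw [Measure.volume_eq_prod, integral_prod]
  swap
  · rw [← Measure.volume_eq_prod]
    exact (integrable_indicator_iff measurableSet_refTri).2 hint
  rw [intervalIntegral.integral_of_le zero_le_one, integral_Ioc_eq_integral_Ioo,
    ← integral_indicator measurableSet_Ioo]
  congr 1
  ext s
  by_cases hs : s ∈ Ioo (0 : ℝ) 1
  · rw [indicator_of_mem hs, intervalIntegral.integral_of_le (by linarith [hs.2]),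
      integral_Ioc_eq_integral_Ioo, ← integral_indicator measurableSet_Ioo]
    congr 1
    ext t
    by_cases ht : t ∈ Ioo 0 (1 - s)
    · rw [indicator_of_mem ht, indicator_of_mem]
      exact ⟨hs.1, ht.1, by simp; linarith [ht.2]⟩
    · rw [indicator_of_notMem ht, indicator_of_notMem]
      rintro ⟨-, h2, h3⟩
      exact ht ⟨h2, by simp at h3; linarith⟩
  · rw [indicator_of_notMem hs]
    have : ∀ t, refTri.indicator G (s, t) = 0 := by
      intro t
      rw [indicator_of_notMem]
      rintro ⟨h1, h2, h3⟩
      simp only at h1 h2 h3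
      exact hs ⟨h1, by linarith⟩
    simp [this]

/-! ### The edge bubble on one triangle -/

/-- The polynomial in two barycentric coordinates that defines the edge bubbles. -/
noncomputable def edgePoly (s t : ℝ) : ℝ := s ^ 2 * t - 5 / 2 * (s ^ 2 * t ^ 2)

/-- The derivative of `edgePoly` in the first variable. -/
def edgePolyFst (s t : ℝ) : ℝ := 2 * s * t - 5 * s * t ^ 2

/-- The derivative of `edgePoly` in the second variable. -/
def edgePolySnd (s t : ℝ) : ℝ := s ^ 2 - 5 * s ^ 2 * t

/-- The edge bubble for the edge `z y` in the triangle `z y a`, times the vector `w`. -/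
noncomputable def polyField (z y a w : Plane) (x : Plane) : Plane :=
  edgePoly (bary z y a x) (bary y z a x) • w

lemma abs_edgePolyFst_le {s t : ℝ} (hs : 0 ≤ s) (ht : 0 ≤ t) (hst : s + t ≤ 1) :
    |edgePolyFst s t| ≤ 7 := by
  have h1 : s * t ≤ 1 := mul_le_one₀ (by linarith) ht (by linarith)
  have h2 : s * t * t ≤ 1 := mul_le_one₀ h1 ht (by linarith)
  have h3 : 0 ≤ s * t := by positivity
  have h4 : 0 ≤ s * t * t := by positivity
  unfold edgePolyFst
  rw [abs_le]
  constructor <;> nlinarith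

lemma abs_edgePolySnd_le {s t : ℝ} (hs : 0 ≤ s) (ht : 0 ≤ t) (hst : s + t ≤ 1) :
    |edgePolySnd s t| ≤ 6 := by
  have h1 : s * s ≤ 1 := mul_le_one₀ (by linarith) hs (by linarith)
  have h2 : s * s * t ≤ 1 := mul_le_one₀ h1 ht (by linarith)
  have h3 : 0 ≤ s * s := by positivity
  have h4 : 0 ≤ s * s * t := by positivity
  unfold edgePolySnd
  rw [abs_le]
  constructor <;> nlinarith

lemma continuous_edgePoly : Continuous fun y : ℝ × ℝ => edgePoly y.1 y.2 := by
  unfold edgePoly; fun_prop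

lemma continuous_edgePolyFst : Continuous fun y : ℝ × ℝ => edgePolyFst y.1 y.2 := by
  unfold edgePolyFst; fun_prop

lemma continuous_edgePolySnd : Continuous fun y : ℝ × ℝ => edgePolySnd y.1 y.2 := by
  unfold edgePolySnd; fun_prop

/-- The origin of the coefficient 5/2. Since `edgePoly` vanishes for s = 0 and for t = 0, the
integral of either partial derivative equals that of `edgePoly` over the side s + t = 1, which is
1/12 − 5/2 · 1/30 = 0. The computation below uses iterated integrals and explicit antiderivatives.
-/
lemma integral_edgePolyFst : ∫ y in refTri, edgePolyFst y.1 y.2 = 0 := by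
  rw [integral_refTri continuous_edgePolyFst]
  have h1 : ∀ s : ℝ, ∫ t in (0 : ℝ)..(1 - s), edgePolyFst s t =
      s * (1 - s) ^ 2 - 5 / 3 * (s * (1 - s) ^ 3) := by
    intro s
    rw [intervalIntegral.integral_eq_sub_of_hasDerivAt
      (f := fun t => s * t ^ 2 - 5 / 3 * (s * t ^ 3))]
    · ring
    · intro t _
      have := (((hasDerivAt_pow 2 t).const_mul s).sub
        (((hasDerivAt_pow 3 t).const_mul s).const_mul (5 / 3)))
      refine this.congr_deriv ?_
      unfold edgePolyFst; norm_num; ring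
    · exact (continuous_edgePolyFst.comp (Continuous.prodMk_right s)).intervalIntegrable _ _
  simp only [h1]
  rw [intervalIntegral.integral_eq_sub_of_hasDerivAt
      (f := fun s => -(1 / 3 * s ^ 2) + s ^ 3 - s ^ 4 + 1 / 3 * s ^ 5)]
  · norm_num
  · intro s _
    have := ((((hasDerivAt_pow 2 s).const_mul (1 / 3)).neg.add (hasDerivAt_pow 3 s)).sub
      (hasDerivAt_pow 4 s)).add
      ((hasDerivAt_pow 5 s).const_mul (1 / 3))
    refine this.congr_deriv ?_
    norm_num; ring
  · exact Continuous.intervalIntegrable (by fun_prop) _ _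

lemma integral_edgePolySnd : ∫ y in refTri, edgePolySnd y.1 y.2 = 0 := by
  rw [integral_refTri continuous_edgePolySnd]
  have h1 : ∀ s : ℝ, ∫ t in (0 : ℝ)..(1 - s), edgePolySnd s t =
      s ^ 2 * (1 - s) - 5 / 2 * (s ^ 2 * (1 - s) ^ 2) := by
    intro s
    rw [intervalIntegral.integral_eq_sub_of_hasDerivAt
      (f := fun t => s ^ 2 * t - 5 / 2 * (s ^ 2 * t ^ 2))]
    · ring
    · intro t _
      have := (((hasDerivAt_id t).const_mul (s ^ 2)).sub
        (((hasDerivAt_pow 2 t).const_mul (s ^ 2)).const_mul (5 / 2)))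
      refine this.congr_deriv ?_
      unfold edgePolySnd; norm_num; ring
    · exact (continuous_edgePolySnd.comp (Continuous.prodMk_right s)).intervalIntegrable _ _
  simp only [h1]
  rw [intervalIntegral.integral_eq_sub_of_hasDerivAt
      (f := fun s => -(1 / 2 * s ^ 3) + s ^ 4 - 1 / 2 * s ^ 5)]
  · norm_num
  · intro s _
    have := (((hasDerivAt_pow 3 s).const_mul (1 / 2)).neg.add (hasDerivAt_pow 4 s)).sub
      ((hasDerivAt_pow 5 s).const_mul (1 / 2))
    refine this.congr_deriv ?_
    norm_num; ring
  · exact Continuous.intervalIntegrable (by fun_prop) _ _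

lemma hasFDerivAt_polyField (z y a w x : Plane) :
    HasFDerivAt (polyField z y a w)
      ((edgePolyFst (bary z y a x) (bary y z a x) • baryGrad z y a +
        edgePolySnd (bary z y a x) (bary y z a x) • baryGrad y z a).smulRight w) x := by
  have h1 := hasFDerivAt_bary z y a x
  have h2 := hasFDerivAt_bary y z a x
  have h : HasFDerivAt (fun x => edgePoly (bary z y a x) (bary y z a x))
      (edgePolyFst (bary z y a x) (bary y z a x) • baryGrad z y a +
        edgePolySnd (bary z y a x) (bary y z a x) • baryGrad y z a) x := by
    unfold edgePoly
    refine (((h1.pow 2).mul h2).sub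
      (((h1.pow 2).mul (h2.pow 2)).const_mul (5 / 2))).congr_fderiv ?_
    ext e
    simp [edgePolyFst, edgePolySnd]
    ring
  exact h.smul_const w

lemma partialDeriv_polyField (z y a w x : Plane) (j i : Fin 2) :
    partialDeriv (polyField z y a w) j i x =
      (edgePolyFst (bary z y a x) (bary y z a x) * baryGrad z y a (EuclideanSpace.single j 1) +
        edgePolySnd (bary z y a x) (bary y z a x) * baryGrad y z a (EuclideanSpace.single j 1)) *
        w i := by
  rw [partialDeriv, (hasFDerivAt_polyField z y a w x).fderiv]
  simp

lemma baryGrad_eq_sum (p q r w : Plane) :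
    baryGrad p q r w = baryGrad p q r (EuclideanSpace.single 0 1) * w 0 +
      baryGrad p q r (EuclideanSpace.single 1 1) * w 1 := by
  simp [baryGrad_apply]; ring

lemma divergence_polyField (z y a w x : Plane) :
    divergence (polyField z y a w) x =
      edgePolyFst (bary z y a x) (bary y z a x) * baryGrad z y a w +
        edgePolySnd (bary z y a x) (bary y z a x) * baryGrad y z a w := by
  rw [divergence, Fin.sum_univ_two, partialDeriv_polyField, partialDeriv_polyField,
    baryGrad_eq_sum z y a w, baryGrad_eq_sum y z a w]
  ring

lemma continuous_divergence_polyField (z y a w : Plane) :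
    Continuous (divergence (polyField z y a w)) := by
  have h : divergence (polyField z y a w) = fun x =>
      edgePolyFst (bary z y a x) (bary y z a x) * baryGrad z y a w +
        edgePolySnd (bary z y a x) (bary y z a x) * baryGrad y z a w :=
    funext (divergence_polyField z y a w)
  have hp := (continuous_bary z y a).prodMk (continuous_bary y z a)
  rw [h]
  exact ((continuous_edgePolyFst.comp hp).mul_const _).add
    ((continuous_edgePolySnd.comp hp).mul_const _)

lemma isCompact_closedTri (u : Finset Plane) : IsCompact (closedTri u) :=
  u.finite_toSet.isCompact_convexHull ℝ

lemma abs_coord_le_norm (w : Plane) (i : Fin 2) : |w i| ≤ ‖w‖ := by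
  simpa using PiLp.norm_apply_le w i

/-- The double zero in λ_z kills the gradient at `y` and `a`. At `z` only the derivative in λ_y
survives, with value 1. The constant 13 is 7 + 6, from the bounds of the two partial derivatives of
`edgePoly`. -/
lemma hasTriData_polyField {z y a : Plane} (h : signedArea z y a ≠ 0) (w : Plane) {g : ℝ}
    (hg1 : ∀ j, |baryGrad z y a (EuclideanSpace.single j 1)| ≤ g)
    (hg2 : ∀ j, |baryGrad y z a (EuclideanSpace.single j 1)| ≤ g) :
    HasTriData {z, y, a} (polyField z y a w)
      (fun σ => if σ = z then baryGrad y z a w else 0) (13 * g * ‖w‖) where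
  poly i := by
    have h1 := isPolyOn_bary z y a (closedTri {z, y, a})
    have h2 := isPolyOn_bary y z a (closedTri {z, y, a})
    refine ((((((h1.mul h1).mul h2).mono (by norm_num : 3 ≤ 4)).add
      (((isPolyOn_const (-5 / 2) _).mul ((h1.mul h1).mul (h2.mul h2))).mono
        (by norm_num))).mul (isPolyOn_const (w i) _))).congr ?_
    intro x _
    simp only [polyField, edgePoly, PiLp.smul_apply, smul_eq_mul]
    ring
  diff x _ := (hasFDerivAt_polyField z y a w x).differentiableAt
  integrable := ((continuous_divergence_polyField z y a w).continuousOn.integrableOn_compact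
    (isCompact_closedTri _)).mono_set interior_subset
  mean := by
    simp only [divergence_polyField]
    refine integral_openTri h
      (fun x => edgePolyFst x.1 x.2 * baryGrad z y a w + edgePolySnd x.1 x.2 * baryGrad y z a w) ?_
    have hi : ∀ {G : ℝ × ℝ → ℝ}, Continuous G → IntegrableOn G refTri := by
      intro G hG
      refine (hG.continuousOn.integrableOn_compact (isCompact_Icc (a := ((0 : ℝ), (0 : ℝ)))
        (b := (1, 1)))).mono_set ?_
      rintro ⟨s, t⟩ ⟨h1, h2, h3⟩
      simp only at h1 h2 h3
      exact ⟨⟨h1.le, h2.le⟩, ⟨by simp; linarith, by simp; linarith⟩⟩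
    rw [integral_add ((hi continuous_edgePolyFst).mul_const _)
      ((hi continuous_edgePolySnd).mul_const _), integral_mul_const, integral_mul_const,
      integral_edgePolyFst, integral_edgePolySnd]
    ring
  lim σ hσ := by
    have hq : signedArea y z a ≠ 0 := by rw [signedArea_swap_left]; simpa
    have hzy : z ≠ y := by
      rintro rfl; apply h; unfold signedArea; ring
    have hza : z ≠ a := by
      rintro rfl; apply h; unfold signedArea; ring
    have h1 := ((continuous_divergence_polyField z y a w).tendsto σ).mono_left
      (nhdsWithin_le_nhds (s := openTri {z, y, a}))
    convert h1 using 2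
    rw [divergence_polyField]
    simp only [Finset.mem_insert, Finset.mem_singleton] at hσ
    rcases hσ with rfl | rfl | rfl
    · simp [bary_self h, bary_left, edgePolyFst, edgePolySnd]
    · simp [bary_self hq, bary_left, edgePolyFst, edgePolySnd, hzy.symm]
    · simp [bary_right, edgePolyFst, edgePolySnd, hza.symm]
  bound x hx i j := by
    obtain ⟨h1, h2, h3⟩ := (mem_openTri_iff h x).1 hx
    have hsum := bary_sum h x
    have e1 := abs_edgePolyFst_le h1.le h2.le (by linarith)
    have e2 := abs_edgePolySnd_le h1.le h2.le (by linarith)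
    have hg0 : 0 ≤ g := (abs_nonneg _).trans (hg1 0)
    rw [partialDeriv_polyField, abs_mul]
    refine mul_le_mul ?_ (abs_coord_le_norm w i) (abs_nonneg _) (by positivity)
    refine (abs_add_le _ _).trans ?_
    rw [abs_mul, abs_mul]
    have f1 := mul_le_mul e1 (hg1 j) (abs_nonneg _) (by norm_num)
    have f2 := mul_le_mul e2 (hg2 j) (abs_nonneg _) (by norm_num)
    linarith

/-- Along a diameter of the ball, of length `2 * R`, the affine coordinate stays between 0 and 1. -/
lemma abs_baryGrad_single_le {p q r c : Plane} {R : ℝ} (h : signedArea p q r ≠ 0) (hR : 0 ≤ R)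
    (hb : Metric.closedBall c R ⊆ closedTri {p, q, r}) (j : Fin 2) :
    |baryGrad p q r (EuclideanSpace.single j 1)| * (2 * R) ≤ 1 := by
  have key : ∀ x ∈ Metric.closedBall c R, 0 ≤ bary p q r x ∧ bary p q r x ≤ 1 := by
    intro x hx
    obtain ⟨h1, h2, h3⟩ := (mem_closedTri_iff h x).1 (hb hx)
    exact ⟨h1, by linarith [bary_sum h x]⟩
  have hm : ∀ t : ℝ, |t| = R → c + t • EuclideanSpace.single j (1 : ℝ) ∈ Metric.closedBall c R := by
    intro t ht
    simp [norm_smul, ht]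
  obtain ⟨a1, a2⟩ := key _ (hm R (abs_of_nonneg hR))
  obtain ⟨b1, b2⟩ := key _ (hm (-R) (by rw [abs_neg, abs_of_nonneg hR]))
  rw [bary_eq p q r _ c, add_sub_cancel_left, map_smul, smul_eq_mul] at a1 a2 b1 b2
  rw [← abs_of_nonneg (by positivity : 0 ≤ 2 * R), ← abs_mul, abs_le]
  constructor <;> nlinarith

/-! ### Shape regular triangulations -/

lemma isBounded_closedTri (u : Finset Plane) : Bornology.IsBounded (closedTri u) :=
  (isCompact_closedTri u).isBounded

lemma dist_le_diam {u : Finset Plane} {x y : Plane} (hx : x ∈ u) (hy : y ∈ u) :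
    dist x y ≤ Metric.diam (closedTri u) :=
  Metric.dist_le_diam_of_mem (isBounded_closedTri u) (subset_convexHull ℝ _ hx)
    (subset_convexHull ℝ _ hy)

lemma diam_closedTri_pos {K : SimplicialComplex ℝ Plane} {u : Finset Plane}
    (hu : u ∈ triangles K) : 0 < Metric.diam (closedTri u) := by
  obtain ⟨z, hz⟩ := Finset.card_pos.1 (by rw [hu.2]; norm_num : 0 < u.card)
  obtain ⟨y, a, rfl⟩ := exists_eq_triple hu hz
  have h1 := (card_triple hu).1
  exact (dist_pos.2 h1).trans_le (dist_le_diam (by simp) (by simp))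

lemma abs_baryGrad_single_mul_le {K : SimplicialComplex ℝ Plane} {ρ : ℝ} (hρ : 0 < ρ)
    (hK : IsShapeRegular K ρ) {p q r : Plane} (hu : {p, q, r} ∈ triangles K) (j : Fin 2) :
    |baryGrad p q r (EuclideanSpace.single j 1)| ≤
      1 / (ρ * Metric.diam (closedTri {p, q, r})) := by
  obtain ⟨c, R, hb, hR⟩ := hK _ hu
  have hd := diam_closedTri_pos hu
  have hpos : 0 < ρ * Metric.diam (closedTri {p, q, r}) := by positivity
  have h1 := abs_baryGrad_single_le (signedArea_ne_zero hu) (by linarith) hb j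
  rw [le_div_iff₀ hpos]
  exact (mul_le_mul_of_nonneg_left hR (abs_nonneg _)).trans h1

/-! ### Global fields -/

/-- A continuous field that vanishes on the boundary of the domain and has the data `d u` and the
bound `B u` on each triangle `u`. -/
structure HasDivData (K : SimplicialComplex ℝ Plane) (v : Plane → Plane)
    (d : Finset Plane → Plane → ℝ) (B : Finset Plane → ℝ) : Prop where
  cont : Continuous v
  zero_frontier : ∀ x ∈ frontier (domain K), v x = 0
  tri : ∀ u ∈ triangles K, HasTriData u v (d u) (B u)

namespace HasDivData

variable {K : SimplicialComplex ℝ Plane} {v v' : Plane → Plane}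
  {d d' : Finset Plane → Plane → ℝ} {B B' : Finset Plane → ℝ}

lemma mem_velocitySpace (h : HasDivData K v d B) : v ∈ velocitySpace K 4 :=
  ⟨h.cont.continuousOn, h.zero_frontier, fun u hu => (h.tri u hu).poly⟩

lemma mono (h : HasDivData K v d B) (hd : ∀ u ∈ triangles K, ∀ σ ∈ u, d u σ = d' u σ)
    (hB : ∀ u ∈ triangles K, B u ≤ B' u) : HasDivData K v d' B' :=
  { h with tri := fun u hu => (h.tri u hu).mono (hd u hu) (hB u hu) }

lemma add (h : HasDivData K v d B) (h' : HasDivData K v' d' B') :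
    HasDivData K (v + v') (fun u σ => d u σ + d' u σ) (fun u => B u + B' u) where
  cont := h.cont.add h'.cont
  zero_frontier x hx := by simp [h.zero_frontier x hx, h'.zero_frontier x hx]
  tri u hu := (h.tri u hu).add (h'.tri u hu)

lemma smul (h : HasDivData K v d B) (c : ℝ) :
    HasDivData K (c • v) (fun u σ => c * d u σ) (fun u => |c| * B u) where
  cont := h.cont.const_smul c
  zero_frontier x hx := by simp [h.zero_frontier x hx]
  tri u hu := (h.tri u hu).smul c

lemma zero (K : SimplicialComplex ℝ Plane) : HasDivData K 0 (fun _ _ => 0) (fun _ => 0) where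
  cont := continuous_zero
  zero_frontier _ _ := rfl
  tri u _ := hasTriData_zero u

lemma sum {ι : Type*} (I : Finset ι) {v : ι → Plane → Plane}
    {d : ι → Finset Plane → Plane → ℝ} {B : ι → Finset Plane → ℝ}
    (h : ∀ i ∈ I, HasDivData K (v i) (d i) (B i)) :
    HasDivData K (∑ i ∈ I, v i) (fun u σ => ∑ i ∈ I, d i u σ) (fun u => ∑ i ∈ I, B i u) := by
  induction I using Finset.induction_on with
  | empty => simpa using zero K
  | insert i I hi ih =>
    simp only [Finset.sum_insert hi]
    exact (h i (Finset.mem_insert_self i I)).add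
      (ih fun j hj => h j (Finset.mem_insert_of_mem hj))

end HasDivData

/-! ### The edge bubble -/

/-- The edge bubble of the edge `z y`, which is nonzero on the two triangles `z y a`
and `z y b` only. -/
noncomputable def edgeFun (z y a b x : Plane) : ℝ :=
  if 0 ≤ signedArea z y x * signedArea z y a then
    edgePoly (max 0 (bary z y a x)) (max 0 (bary y z a x))
  else edgePoly (max 0 (bary z y b x)) (max 0 (bary y z b x))

/-- On the line through `z` and `y` the coordinate at `z` depends only on the position relative to
`z` and `y`, not on the third vertex. Hence the two branches of `edgeFun` match along the edge. -/
lemma bary_eq_of_signedArea_eq_zero {z y a b x : Plane} (ha : signedArea z y a ≠ 0)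
    (hb : signedArea z y b ≠ 0) (hx : signedArea z y x = 0) : bary z y a x = bary z y b x := by
  rw [bary, bary, div_eq_div_iff ha hb]
  unfold signedArea at *
  linear_combination ((a 0 - y 0) * (b 1 - y 1) - (a 1 - y 1) * (b 0 - y 0)) * hx

lemma edgeFun_eq_left {z y a b x : Plane} (h : 0 ≤ signedArea z y x * signedArea z y a) :
    edgeFun z y a b x = edgePoly (max 0 (bary z y a x)) (max 0 (bary y z a x)) := if_pos h

lemma signedArea_swap_left_ne {p q r : Plane} (h : signedArea p q r ≠ 0) :
    signedArea q p r ≠ 0 := by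
  rw [signedArea_swap_left]; simpa

lemma edgeFun_eq_right {z y a b x : Plane} (hab : signedArea z y a * signedArea z y b < 0)
    (h : 0 ≤ signedArea z y x * signedArea z y b) :
    edgeFun z y a b x = edgePoly (max 0 (bary z y b x)) (max 0 (bary y z b x)) := by
  have ha : signedArea z y a ≠ 0 := by rintro h; simp [h] at hab
  have hb : signedArea z y b ≠ 0 := by rintro h; simp [h] at hab
  by_cases hx : signedArea z y x = 0
  · have hx' : signedArea y z x = 0 := by rw [signedArea_swap_left, hx, neg_zero]
    rw [edgeFun_eq_left (by simp [hx]), bary_eq_of_signedArea_eq_zero ha hb hx,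
      bary_eq_of_signedArea_eq_zero (signedArea_swap_left_ne ha) (signedArea_swap_left_ne hb) hx']
  · refine if_neg fun hcon => ?_
    have h1 : 0 < signedArea z y x * signedArea z y a := hcon.lt_of_ne (mul_ne_zero hx ha).symm
    have h2 : 0 < signedArea z y x * signedArea z y b := h.lt_of_ne (mul_ne_zero hx hb).symm
    nlinarith [mul_pos h1 h2, mul_neg_of_pos_of_neg (sq_pos_of_ne_zero hx) hab]

lemma continuous_edgeFun {z y a b : Plane} (hab : signedArea z y a * signedArea z y b < 0) :
    Continuous (edgeFun z y a b) := by
  have hc : ∀ c, Continuous fun x => edgePoly (max 0 (bary z y c x)) (max 0 (bary y z c x)) := by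
    intro c
    exact continuous_edgePoly.comp ((continuous_const.max (continuous_bary z y c)).prodMk
      (continuous_const.max (continuous_bary y z c)))
  have hs : Continuous fun x => signedArea z y x * signedArea z y a := by
    unfold signedArea; fun_prop
  refine Continuous.if_le (hc a) (hc b) continuous_const hs ?_
  intro x hx
  have ha : signedArea z y a ≠ 0 := by rintro h; simp [h] at hab
  have hx0 : signedArea z y x = 0 := (mul_eq_zero.1 hx.symm).resolve_right ha
  rw [← edgeFun_eq_left (b := b) hx.le, edgeFun_eq_right hab (by simp [hx0])]

/-- Because `edgePoly` has the factor s²t, clamping the coordinates at 0 extends the bubble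
continuously by zero across the lines `y a` and `z a`. -/
lemma edgePoly_max_ne_zero {s t : ℝ} (h : edgePoly (max 0 s) (max 0 t) ≠ 0) : 0 < s ∧ 0 < t := by
  constructor <;> by_contra hcon <;> apply h <;> rw [not_lt] at hcon <;>
    simp [edgePoly, max_eq_left hcon]

lemma bary_opposite (z y a x : Plane) : bary a z y x = signedArea z y x / signedArea z y a := by
  rw [bary, ← signedArea_rotate x z y, ← signedArea_rotate a z y]

lemma bary_opposite_nonneg_iff {z y a x : Plane} (ha : signedArea z y a ≠ 0) :
    0 ≤ bary a z y x ↔ 0 ≤ signedArea z y x * signedArea z y a := by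
  rw [bary_opposite]
  constructor
  · intro h
    have := mul_nonneg h (sq_nonneg (signedArea z y a))
    rwa [pow_two, ← mul_assoc, div_mul_cancel₀ _ ha] at this
  · intro h
    rw [← mul_div_mul_right _ _ ha]
    exact div_nonneg h (mul_self_nonneg _)

/-- Where the edge bubble does not vanish. -/
lemma edgeFun_ne_zero {z y a b x : Plane} (hab : signedArea z y a * signedArea z y b < 0)
    (h : edgeFun z y a b x ≠ 0) : ∃ c, (c = a ∨ c = b) ∧ x ∈ closedTri {z, y, c} ∧
      0 < bary z y c x ∧ 0 < bary y z c x := by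
  have ha : signedArea z y a ≠ 0 := by rintro h; simp [h] at hab
  have hb : signedArea z y b ≠ 0 := by rintro h; simp [h] at hab
  by_cases hx : 0 ≤ signedArea z y x * signedArea z y a
  · rw [edgeFun_eq_left hx] at h
    obtain ⟨h1, h2⟩ := edgePoly_max_ne_zero h
    exact ⟨a, Or.inl rfl, (mem_closedTri_iff ha x).2
      ⟨h1.le, h2.le, (bary_opposite_nonneg_iff ha).2 hx⟩, h1, h2⟩
  · have hx' : 0 ≤ signedArea z y x * signedArea z y b := by
      by_contra hcon
      rw [not_le] at hx hcon
      nlinarith [mul_pos_of_neg_of_neg hx hcon, mul_nonpos_of_nonneg_of_nonpos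
        (sq_nonneg (signedArea z y x)) hab.le]
    rw [edgeFun_eq_right hab hx'] at h
    obtain ⟨h1, h2⟩ := edgePoly_max_ne_zero h
    exact ⟨b, Or.inr rfl, (mem_closedTri_iff hb x).2
      ⟨h1.le, h2.le, (bary_opposite_nonneg_iff hb).2 hx'⟩, h1, h2⟩

/-- Applied to the set where a bubble is nonzero, which is open and contained in two triangles, this
gives the boundary condition. -/
lemma frontier_domain_notMem (K : SimplicialComplex ℝ Plane) {U : Set Plane} (hU : IsOpen U)
    (hUK : U ⊆ K.space) {x : Plane} (hx : x ∈ frontier (domain K)) : x ∉ U := by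
  intro hxU
  have h1 : x ∈ domain K := interior_maximal hUK hU hxU
  rw [domain, isOpen_interior.frontier_eq] at hx
  exact hx.2 h1

/-- The field belonging to an edge with endpoint `z` and a vector. -/
lemma exists_edgeField {K : SimplicialComplex ℝ Plane} {ρ : ℝ} (hρ : 0 < ρ)
    (hK : IsShapeRegular K ρ) {z y a b : Plane} (hs : {z, y, a} ∈ triangles K)
    (ht : {z, y, b} ∈ triangles K) (hab : a ≠ b) (w : Plane) {c : ℝ}
    (hw : ‖w‖ ≤ c * dist z y) :
    ∃ v, HasDivData K v
      (fun u σ => if σ = z then (if u = {z, y, a} then baryGrad y z a w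
        else if u = {z, y, b} then baryGrad y z b w else 0) else 0)
      (fun u => if z ∈ u then 13 / ρ * c else 0) := by
  have hneg := signedArea_mul_neg hs ht hab
  have ha := signedArea_ne_zero hs
  have hb := signedArea_ne_zero ht
  have hc0 : 0 ≤ c := by
    have := (norm_nonneg w).trans hw
    exact nonneg_of_mul_nonneg_left this (dist_pos.2 (card_triple hs).1)
  have hbound : ∀ c', {z, y, c'} ∈ triangles K → HasTriData {z, y, c'} (polyField z y c' w)
      (fun σ => if σ = z then baryGrad y z c' w else 0) (13 / ρ * c) := by
    intro c' h'
    have hrot : ({y, z, c'} : Finset Plane) = {z, y, c'} := triple_rotate _ _ _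
    have h'' : {y, z, c'} ∈ triangles K := hrot ▸ h'
    have hg1 := abs_baryGrad_single_mul_le hρ hK h'
    have hg2 := abs_baryGrad_single_mul_le hρ hK h''
    rw [hrot] at hg2
    refine (hasTriData_polyField (signedArea_ne_zero h') w hg1 hg2).mono (fun _ _ => rfl) ?_
    have hd := diam_closedTri_pos h'
    have h1 : ‖w‖ ≤ c * Metric.diam (closedTri {z, y, c'}) :=
      hw.trans (mul_le_mul_of_nonneg_left (dist_le_diam (by simp) (by simp)) hc0)
    -- The bubble gradient scales like 1 / diam and `w` like diam, so the bound is independent of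
    -- the mesh size.
    calc 13 * (1 / (ρ * Metric.diam (closedTri {z, y, c'}))) * ‖w‖
        ≤ 13 * (1 / (ρ * Metric.diam (closedTri {z, y, c'}))) *
          (c * Metric.diam (closedTri {z, y, c'})) := by gcongr
      _ = 13 / ρ * c := by field_simp
  have hmax : ∀ c', {z, y, c'} ∈ triangles K → ∀ x ∈ closedTri {z, y, c'},
      0 ≤ signedArea z y x * signedArea z y c' ∧ max 0 (bary z y c' x) = bary z y c' x ∧
      max 0 (bary y z c' x) = bary y z c' x := by
    intro c' h' x hx
    have h0 := signedArea_ne_zero h'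
    obtain ⟨h1, h2, h3⟩ := (mem_closedTri_iff h0 x).1 hx
    exact ⟨(bary_opposite_nonneg_iff h0).1 h3, max_eq_right h1, max_eq_right h2⟩
  have hne : ({z, y, b} : Finset Plane) ≠ {z, y, a} := by
    intro h
    have : b ∈ ({z, y, a} : Finset Plane) := h ▸ (by simp)
    obtain ⟨-, n1, n2⟩ := card_triple ht
    simp [n1.symm, n2.symm, hab.symm] at this
  refine ⟨fun x => edgeFun z y a b x • w, (continuous_edgeFun hneg).smul continuous_const, ?_, ?_⟩
  · intro x hx
    have hU : IsOpen {x | edgeFun z y a b x ≠ 0} :=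
      isOpen_ne_fun (continuous_edgeFun hneg) continuous_const
    have := frontier_domain_notMem K hU (fun x hx => by
      obtain ⟨c', hc', hmem, -⟩ := edgeFun_ne_zero hneg hx
      rcases hc' with rfl | rfl
      · exact SimplicialComplex.convexHull_subset_space hs.1 hmem
      · exact SimplicialComplex.convexHull_subset_space ht.1 hmem) hx
    simp only [mem_ofPred_eq, not_not] at this
    simp [this]
  · intro u hu
    by_cases h1 : u = {z, y, a}
    · subst h1
      refine ((hbound a hs).congr ?_).mono (fun σ _ => by simp) (by simp)
      intro x hx
      obtain ⟨e1, e2, e3⟩ := hmax a hs x hx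
      simp only [polyField]
      rw [edgeFun_eq_left e1, e2, e3]
    by_cases h2 : u = {z, y, b}
    · subst h2
      refine ((hbound b ht).congr ?_).mono (fun σ _ => by simp [hne]) (by simp)
      intro x hx
      obtain ⟨e1, e2, e3⟩ := hmax b ht x hx
      simp only [polyField]
      rw [edgeFun_eq_right hneg e1, e2, e3]
    · refine ((hasTriData_zero u).congr ?_).mono (fun σ _ => by simp [h1, h2])
        (by split_ifs <;> positivity)
      intro x hx
      -- At a point of `u` with nonzero bubble the coordinates at `z` and `y` are positive, so `u`
      -- contains the edge `z y` and is one of its two triangles.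
      have : edgeFun z y a b x = 0 := by
        by_contra hne0
        obtain ⟨c', hc', hmem, p1, p2⟩ := edgeFun_ne_zero hneg hne0
        have h' : {z, y, c'} ∈ triangles K := by rcases hc' with rfl | rfl <;> assumption
        have hrot : ({y, z, c'} : Finset Plane) = {z, y, c'} := triple_rotate _ _ _
        have m1 := mem_of_bary_pos h' hu hmem hx p1
        have m2 := mem_of_bary_pos (hrot ▸ h') hu (hrot ▸ hmem) hx p2
        rcases eq_or_eq_of_edge_subset hs ht hab hu m1 m2 with h | h
        · exact h1 h
        · exact h2 h
      simp [this]

/-! ### Angles -/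

/-- As `a` and `b` are on opposite sides of the line `z y`, the angles add up to the turn from `a`
to `b` through `y`, and both sides are twice the area of `z a b`. Multiplied by |y − z|², the
addition formula for the sine becomes a polynomial identity in dot and cross products. -/
lemma abs_sin_angle_add_mul {z y a b : Plane} (hneg : signedArea z y a * signedArea z y b < 0) :
    |Real.sin (EuclideanGeometry.angle a z y + EuclideanGeometry.angle y z b)| *
      (dist a z * dist b z) = |signedArea z a b| := by
  have hzy : z ≠ y := by
    rintro rfl
    simp [signedArea] at hneg
  have hin : ∀ u v : Plane, inner ℝ u v = u 0 * v 0 + u 1 * v 1 := by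
    intro u v; simp [PiLp.inner_apply, Fin.sum_univ_two]; ring
  have hcos := fun u v : Plane => InnerProductGeometry.cos_angle_mul_norm_mul_norm u v
  have hsin : ∀ u v : Plane, Real.sin (InnerProductGeometry.angle u v) * (‖u‖ * ‖v‖) =
      |u 0 * v 1 - u 1 * v 0| := by
    intro u v
    rw [InnerProductGeometry.sin_angle_mul_norm_mul_norm, hin, hin, hin, ← Real.sqrt_sq_eq_abs]
    congr 1; ring
  have hN : ‖y - z‖ * ‖y - z‖ = (y 0 - z 0) ^ 2 + (y 1 - z 1) ^ 2 := by
    rw [← real_inner_self_eq_norm_mul_norm, hin]; simp; ring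
  have hNpos : 0 < ‖y - z‖ * ‖y - z‖ := by
    have : 0 < ‖y - z‖ := norm_pos_iff.2 (sub_ne_zero.2 hzy.symm)
    positivity
  have h1 := hcos (a - z) (y - z)
  have h2 := hcos (y - z) (b - z)
  have h3 := hsin (a - z) (y - z)
  have h4 := hsin (y - z) (b - z)
  rw [hin] at h1 h2
  rw [EuclideanGeometry.angle, EuclideanGeometry.angle, Real.sin_add, dist_eq_norm, dist_eq_norm,
    vsub_eq_sub, vsub_eq_sub, vsub_eq_sub]
  simp only [PiLp.sub_apply] at h1 h2 h3 h4
  set S1 := Real.sin (InnerProductGeometry.angle (a - z) (y - z))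
  set C1 := Real.cos (InnerProductGeometry.angle (a - z) (y - z))
  set S2 := Real.sin (InnerProductGeometry.angle (y - z) (b - z))
  set C2 := Real.cos (InnerProductGeometry.angle (y - z) (b - z))
  have key : |(S1 * C2 + C1 * S2) * (‖a - z‖ * ‖b - z‖) * (‖y - z‖ * ‖y - z‖)| =
      |signedArea z a b * (‖y - z‖ * ‖y - z‖)| := by
    have e : (S1 * C2 + C1 * S2) * (‖a - z‖ * ‖b - z‖) * (‖y - z‖ * ‖y - z‖) =
        (S1 * (‖a - z‖ * ‖y - z‖)) * (C2 * (‖y - z‖ * ‖b - z‖)) +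
        (C1 * (‖a - z‖ * ‖y - z‖)) * (S2 * (‖y - z‖ * ‖b - z‖)) := by ring
    have ea : (a 0 - z 0) * (y 1 - z 1) - (a 1 - z 1) * (y 0 - z 0) = -signedArea z y a := by
      unfold signedArea; ring
    have eb : (y 0 - z 0) * (b 1 - z 1) - (y 1 - z 1) * (b 0 - z 0) = signedArea z y b := rfl
    rw [e, h1, h2, h3, h4, hN, ea, eb]
    rcases mul_neg_iff.1 hneg with ⟨p1, p2⟩ | ⟨p1, p2⟩
    · rw [abs_neg, abs_of_pos p1, abs_of_neg p2, ← abs_neg]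
      congr 1
      unfold signedArea; ring
    · rw [abs_neg, abs_of_neg p1, abs_of_pos p2]
      congr 1
      unfold signedArea; ring
  rw [abs_mul, abs_mul _ (‖y - z‖ * ‖y - z‖), abs_of_pos hNpos] at key
  have key2 := mul_right_cancel₀ hNpos.ne' key
  rw [abs_mul, abs_of_nonneg (by positivity : 0 ≤ ‖a - z‖ * ‖b - z‖)] at key2
  exact key2

lemma abs_signedArea_le (z y a : Plane) : |signedArea z y a| ≤ dist z y * dist a z := by
  have hin : ∀ u v : Plane, inner ℝ u v = u 0 * v 0 + u 1 * v 1 := by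
    intro u v; simp [PiLp.inner_apply, Fin.sum_univ_two]; ring
  rw [dist_comm z y, dist_eq_norm, dist_eq_norm]
  refine abs_le_of_sq_le_sq ?_ (by positivity)
  have h1 : ∀ u : Plane, ‖u‖ ^ 2 = u 0 ^ 2 + u 1 ^ 2 := by
    intro u; rw [← real_inner_self_eq_norm_sq, hin]; ring
  rw [mul_pow, h1, h1]
  simp only [PiLp.sub_apply]
  unfold signedArea
  nlinarith [sq_nonneg ((y 0 - z 0) * (a 0 - z 0) + (y 1 - z 1) * (a 1 - z 1))]

/-- The data of a field with divergence `G` at the vertex `z` and zero at the other vertices. -/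
noncomputable def vertexData (z : Plane) (G : Finset Plane → ℝ) (u : Finset Plane) (σ : Plane) : ℝ :=
  if σ = z then G u else 0

/-- A bound on the triangles with vertex `z`. -/
noncomputable def vertexBound (z : Plane) (B : ℝ) (u : Finset Plane) : ℝ := if z ∈ u then B else 0

/-- Take `w = y - z`: the coordinate at `y` grows from 0 to 1 along the edge, whichever side it is
seen from. -/
lemma exists_tangentialField {K : SimplicialComplex ℝ Plane} {ρ : ℝ} (hρ : 0 < ρ)
    (hK : IsShapeRegular K ρ) {z y a b : Plane} (hs : {z, y, a} ∈ triangles K)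
    (ht : {z, y, b} ∈ triangles K) (hab : a ≠ b) :
    ∃ v, HasDivData K v
      (vertexData z fun u => if u = {z, y, a} ∨ u = {z, y, b} then 1 else 0)
      (vertexBound z (13 / ρ)) := by
  have h1 : ∀ c, {z, y, c} ∈ triangles K → baryGrad y z c (y - z) = 1 := by
    intro c hc
    rw [← bary_sub_bary, bary_self (signedArea_swap_left_ne (signedArea_ne_zero hc)), bary_left,
      sub_zero]
  obtain ⟨v, hv⟩ := exists_edgeField hρ hK hs ht hab (y - z) (c := 1)
    (by rw [one_mul, dist_comm, dist_eq_norm])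
  refine ⟨v, hv.mono ?_ ?_⟩
  · intro u _ σ _
    simp only [vertexData, h1 a hs, h1 b ht]
    by_cases e1 : u = {z, y, a} <;> by_cases e2 : u = {z, y, b} <;> simp [e1, e2]
  · intro u _
    simp [vertexBound]

/-- Take `w` parallel to `b - z`. In `z y b` the coordinate at `y` vanishes along `z b`, so the
divergence at `z` is 0 there; in `z y a` it can be scaled to 1 unless `z`, `a`, `b` are collinear.
By `abs_sin_angle_add_mul` the nonzero sine excludes this, and |w| ≤ |z − y| / |sin (θ + θ')|. -/
lemma exists_singleField {K : SimplicialComplex ℝ Plane} {ρ : ℝ} (hρ : 0 < ρ)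
    (hK : IsShapeRegular K ρ) {z y a b : Plane} (hs : {z, y, a} ∈ triangles K)
    (ht : {z, y, b} ∈ triangles K) (hab : a ≠ b) {τ : ℝ}
    (hsin : Real.sin (EuclideanGeometry.angle a z y + EuclideanGeometry.angle y z b) ≠ 0)
    (hτ : 1 / |Real.sin (EuclideanGeometry.angle a z y + EuclideanGeometry.angle y z b)| ≤ τ) :
    ∃ v, HasDivData K v (vertexData z fun u => if u = {z, y, a} then 1 else 0)
      (vertexBound z (13 / ρ * τ)) := by
  have hneg := signedArea_mul_neg hs ht hab
  have hmul := abs_sin_angle_add_mul hneg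
  set σ := EuclideanGeometry.angle a z y + EuclideanGeometry.angle y z b
  have ha := signedArea_ne_zero hs
  have hb := signedArea_ne_zero ht
  have hzb : 0 < dist b z := dist_pos.2 (card_triple ht).2.1.symm
  have hza : 0 < dist a z := dist_pos.2 (card_triple hs).2.1.symm
  have hpos : 0 < |Real.sin σ| := abs_pos.2 hsin
  have hne : signedArea z b a ≠ 0 := by
    rw [signedArea_swap]
    intro h
    rw [neg_eq_zero] at h
    rw [h, abs_zero] at hmul
    have : 0 < |Real.sin σ| * (dist a z * dist b z) := by positivity
    exact this.ne' hmul
  have hwn : ‖(signedArea z y a / signedArea z b a) • (b - z)‖ ≤ τ * dist z y := by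
    have h1 : |signedArea z b a| = |Real.sin σ| * (dist a z * dist b z) := by
      rw [hmul, signedArea_swap, abs_neg]
    have h2 := abs_signedArea_le z y a
    rw [norm_smul, Real.norm_eq_abs, abs_div, h1, ← dist_eq_norm]
    have h3 : 1 / |Real.sin σ| * dist z y ≤ τ * dist z y := by gcongr
    refine le_trans ?_ h3
    calc |signedArea z y a| / (|Real.sin σ| * (dist a z * dist b z)) * dist b z
        ≤ (dist z y * dist a z) / (|Real.sin σ| * (dist a z * dist b z)) * dist b z := by gcongr
      _ = 1 / |Real.sin σ| * dist z y := by field_simp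
  obtain ⟨v, hv⟩ := exists_edgeField hρ hK hs ht hab _ hwn
  refine ⟨v, hv.mono ?_ ?_⟩
  · intro u _ σ _
    have e1 : baryGrad y z a ((signedArea z y a / signedArea z b a) • (b - z)) = 1 := by
      have h0 := signedArea_swap_left z y a
      rw [map_smul, baryGrad_apply, h0, smul_eq_mul]
      field_simp
      simp only [PiLp.sub_apply]
      unfold signedArea
      ring
    have e2 : baryGrad y z b ((signedArea z y a / signedArea z b a) • (b - z)) = 0 := by
      rw [map_smul, ← bary_sub_bary, bary_right, bary_left, sub_zero, smul_zero]
    simp [vertexData, e1, e2]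
  · intro u _
    simp [vertexBound]

/-! ### Alternating sums -/

/-- The alternating sum of `g 1, …, g N`. -/
def altSum (g : ℕ → ℝ) : ℕ → ℝ
  | 0 => 0
  | n + 1 => g (n + 1) - altSum g n

lemma altSum_eq_sum (g : ℕ → ℝ) (N : ℕ) :
    altSum g N = ∑ j ∈ Finset.Icc 1 N, (-1 : ℝ) ^ (N - j) * g j := by
  induction N with
  | zero => simp [altSum]
  | succ n ih =>
    rw [altSum, ih, Finset.sum_Icc_succ_top (by omega)]
    have : ∑ j ∈ Finset.Icc 1 n, (-1 : ℝ) ^ (n + 1 - j) * g j =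
        -∑ j ∈ Finset.Icc 1 n, (-1 : ℝ) ^ (n - j) * g j := by
      rw [← Finset.sum_neg_distrib]
      refine Finset.sum_congr rfl fun j hj => ?_
      rw [Finset.mem_Icc] at hj
      rw [Nat.succ_sub hj.2, pow_succ]
      ring
    rw [this]
    simp
    ring

lemma abs_altSum_le (g : ℕ → ℝ) {m N : ℕ} (hm : m ≤ N) :
    |altSum g m| ≤ ∑ j ∈ Finset.Icc 1 N, |g j| := by
  rw [altSum_eq_sum]
  refine (Finset.abs_sum_le_sum_abs _ _).trans ?_
  simp only [abs_mul, abs_pow, abs_neg, abs_one, one_pow, one_mul]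
  exact Finset.sum_le_sum_of_subset_of_nonneg (Finset.Icc_subset_Icc_right hm)
    fun _ _ _ => abs_nonneg _

/-- The recursion says `altSum g j + altSum g (j - 1) = g j`, so the partial alternating sums are
the coefficients of `g` in terms of e_m + e_{m+1}. The terms missing at the ends are `altSum g 0`,
zero by definition, and `altSum g N`, zero by hypothesis. -/
lemma sum_altSum_mul {g : ℕ → ℝ} {N j : ℕ} (hN : altSum g N = 0) (hj : j ∈ Icc 1 N) :
    ∑ m ∈ Finset.Ico 1 N, altSum g m * (if j = m ∨ j = m + 1 then 1 else 0) = g j := by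
  obtain ⟨hj1, hj2⟩ := hj
  obtain ⟨i, rfl⟩ : ∃ i, j = i + 1 := ⟨j - 1, by omega⟩
  have h1 : ∀ m ∈ Finset.Ico 1 N, altSum g m * (if i + 1 = m ∨ i + 1 = m + 1 then (1 : ℝ) else 0) =
      (if i + 1 = m then altSum g m else 0) + (if i = m then altSum g m else 0) := by
    intro m _
    by_cases e1 : i + 1 = m
    · have : i ≠ m := by omega
      simp [e1, this]
    · by_cases e2 : i = m <;> simp [e1, e2]
  rw [Finset.sum_congr rfl h1, Finset.sum_add_distrib, Finset.sum_ite_eq, Finset.sum_ite_eq]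
  have h2 : (if i + 1 ∈ Finset.Ico 1 N then altSum g (i + 1) else 0) = altSum g (i + 1) := by
    split_ifs with h
    · rfl
    · rw [Finset.mem_Ico] at h
      rw [show i + 1 = N by omega, hN]
  have h3 : (if i ∈ Finset.Ico 1 N then altSum g i else 0) = altSum g i := by
    split_ifs with h
    · rfl
    · rw [Finset.mem_Ico] at h
      rw [show i = 0 by omega, altSum]
  rw [h2, h3, altSum]
  ring

/-! ### Fields with prescribed divergence at a vertex -/

/-- The common edge contains `z`: otherwise both triangles would be the edge with `z` added, against
injectivity of the enumeration. -/
lemma IsStarEnumeration.exists_edge {K : SimplicialComplex ℝ Plane} {z : Plane} {N : ℕ}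
    {τ : ℕ → Finset Plane} (E : IsStarEnumeration K z N τ) {j : ℕ} (h1 : 1 ≤ j) (h2 : j < N) :
    ∃ y a b, a ≠ b ∧ τ j = {z, y, a} ∧ τ (j + 1) = {z, y, b} := by
  have m1 := E.bijOn.mapsTo (show j ∈ Icc 1 N from ⟨h1, h2.le⟩)
  have m2 := E.bijOn.mapsTo (show j + 1 ∈ Icc 1 N from ⟨by omega, h2⟩)
  have hne : τ j ≠ τ (j + 1) := fun h => by
    have := E.bijOn.injOn (show j ∈ Icc 1 N from ⟨h1, h2.le⟩)
      (show j + 1 ∈ Icc 1 N from ⟨by omega, h2⟩) h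
    omega
  obtain ⟨e, -, he, hes, het⟩ := E.consecutive j h1 h2
  have hze : z ∈ e := by
    by_contra hz
    have hc : ∀ u, u.card = 3 → z ∈ u → e ⊆ u → insert z e = u := by
      intro u hu hzu heu
      refine Finset.eq_of_subset_of_card_le (Finset.insert_subset hzu heu) ?_
      rw [Finset.card_insert_of_notMem hz, he, hu]
    exact hne ((hc _ m1.1.2 m1.2 hes).symm.trans (hc _ m2.1.2 m2.2 het))
  obtain ⟨y, hye, hyz⟩ := Finset.exists_mem_ne (by rw [he]; norm_num : 1 < e.card) z
  obtain ⟨a, ha⟩ := exists_eq_triple_of_edge m1.1 m1.2 (hes hye) hyz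
  obtain ⟨b, hb⟩ := exists_eq_triple_of_edge m2.1 m2.2 (het hye) hyz
  refine ⟨y, a, b, ?_, ha, hb⟩
  rintro rfl
  exact hne (ha.trans hb.symm)

/-- Tangential fields on the edges between consecutive triangles are combined with the coefficients
of `sum_altSum_mul`. There are at most `N` of them, each coefficient being at most the sum of the
|G|. -/
lemma exists_vertexField_of_altSum_eq_zero {K : SimplicialComplex ℝ Plane} {ρ : ℝ} (hρ : 0 < ρ)
    (hK : IsShapeRegular K ρ) {z : Plane} {N : ℕ} {τ : ℕ → Finset Plane}
    (E : IsStarEnumeration K z N τ) (G : Finset Plane → ℝ)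
    (hG : altSum (fun j => G (τ j)) N = 0) :
    ∃ v, HasDivData K v (vertexData z G)
      (vertexBound z (13 / ρ * (N * ∑ j ∈ Finset.Icc 1 N, |G (τ j)|))) := by
  have hT : ∀ m, ∃ v, m ∈ Finset.Ico 1 N → HasDivData K v
      (vertexData z fun u => if u = τ m ∨ u = τ (m + 1) then 1 else 0)
      (vertexBound z (13 / ρ)) := by
    intro m
    by_cases hm : m ∈ Finset.Ico 1 N
    · rw [Finset.mem_Ico] at hm
      obtain ⟨y, a, b, hab, ha, hb⟩ := E.exists_edge hm.1 hm.2
      have m1 := (E.bijOn.mapsTo (show m ∈ Icc 1 N from ⟨hm.1, hm.2.le⟩)).1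
      have m2 := (E.bijOn.mapsTo (show m + 1 ∈ Icc 1 N from ⟨by omega, hm.2⟩)).1
      rw [ha] at m1
      rw [hb] at m2
      obtain ⟨v, hv⟩ := exists_tangentialField hρ hK m1 m2 hab
      exact ⟨v, fun _ => by rw [ha, hb]; exact hv⟩
    · exact ⟨0, fun h => absurd h hm⟩
  choose T hT using hT
  refine ⟨∑ m ∈ Finset.Ico 1 N, altSum (fun j => G (τ j)) m • T m,
    (HasDivData.sum _ fun m hm => (hT m hm).smul (altSum (fun j => G (τ j)) m)).mono ?_ ?_⟩
  · intro u hu σ hσ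
    by_cases h : σ = z
    · subst h
      obtain ⟨j, hj, rfl⟩ := E.bijOn.surjOn (show u ∈ star K σ from ⟨hu, hσ⟩)
      simp only [vertexData, if_true]
      rw [← sum_altSum_mul hG hj]
      refine Finset.sum_congr rfl fun m hm => ?_
      rw [Finset.mem_Ico] at hm
      simp only [E.bijOn.injOn.eq_iff hj ⟨hm.1, hm.2.le⟩,
        E.bijOn.injOn.eq_iff hj ⟨by omega, hm.2⟩]
    · simp [vertexData, h]
  · intro u _
    by_cases h : z ∈ u
    · simp only [vertexBound, h, if_true]
      rw [← Finset.sum_mul, mul_comm]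
      refine mul_le_mul_of_nonneg_left ?_ (by positivity)
      refine (Finset.sum_le_card_nsmul _ _ (∑ j ∈ Finset.Icc 1 N, |G (τ j)|) fun m hm => ?_).trans ?_
      · rw [Finset.mem_Ico] at hm
        exact abs_altSum_le (fun j => G (τ j)) hm.2.le
      · rw [Nat.card_Ico, nsmul_eq_mul]
        refine mul_le_mul_of_nonneg_right ?_ (Finset.sum_nonneg fun _ _ => abs_nonneg _)
        exact_mod_cast Nat.sub_le N 1
    · simp [vertexBound, h]

/-- At a vertex that is not singular, with an edge at which `1 / |sin (θ + θ')|` is bounded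
by `κ`, all values of the divergence can be prescribed. -/
lemma exists_vertexField_of_sin_ne_zero {K : SimplicialComplex ℝ Plane} {ρ : ℝ} (hρ : 0 < ρ)
    (hK : IsShapeRegular K ρ) {z : Plane} {N : ℕ} {τ : ℕ → Finset Plane}
    (E : IsStarEnumeration K z N τ) (G : Finset Plane → ℝ) {y a b : Plane}
    (hs : {z, y, a} ∈ triangles K) (ht : {z, y, b} ∈ triangles K) (hab : a ≠ b) {κ : ℝ}
    (hsin : Real.sin (EuclideanGeometry.angle a z y + EuclideanGeometry.angle y z b) ≠ 0)
    (hκ : 1 / |Real.sin (EuclideanGeometry.angle a z y + EuclideanGeometry.angle y z b)| ≤ κ) :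
    ∃ v, HasDivData K v (vertexData z G)
      (vertexBound z (13 / ρ * ((2 * N + κ) * ∑ j ∈ Finset.Icc 1 N, |G (τ j)|))) := by
  obtain ⟨X, hX⟩ := exists_singleField hρ hK hs ht hab hsin hκ
  have hκ0 : 0 ≤ κ := le_trans (by positivity) hκ
  obtain ⟨i, hi, his⟩ := E.bijOn.surjOn (show {z, y, a} ∈ star K z from ⟨hs, by simp⟩)
  rw [← his] at hX
  set A := ∑ j ∈ Finset.Icc 1 N, |G (τ j)| with hA
  -- The triangle `τ i` enters the alternating sum with the sign `(-1) ^ (N - i)`, so lowering its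
  -- value by `c` makes the sum vanish. The field `c • X` restores it.
  set c : ℝ := (-1) ^ (N - i) * altSum (fun j => G (τ j)) N with hc
  have hcA : |c| ≤ A := by
    rw [hc, abs_mul, abs_pow, abs_neg, abs_one, one_pow, one_mul]
    exact abs_altSum_le (fun j => G (τ j)) le_rfl
  let G' : Finset Plane → ℝ := fun u => G u - c * (if u = τ i then 1 else 0)
  have hi' : i ∈ Finset.Icc 1 N := Finset.mem_Icc.2 hi
  have hτ : ∀ j ∈ Finset.Icc 1 N, (if τ j = τ i then (1 : ℝ) else 0) = if j = i then 1 else 0 := by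
    intro j hj
    simp only [E.bijOn.injOn.eq_iff (Finset.mem_Icc.1 hj) hi]
  have hsum : altSum (fun j => G' (τ j)) N = 0 := by
    rw [altSum_eq_sum]
    have : ∀ j ∈ Finset.Icc 1 N, (-1 : ℝ) ^ (N - j) * G' (τ j) =
        (-1 : ℝ) ^ (N - j) * G (τ j) - if j = i then (-1 : ℝ) ^ (N - j) * c else 0 := by
      intro j hj
      simp only [G', hτ j hj]
      split_ifs <;> ring
    rw [Finset.sum_congr rfl this, Finset.sum_sub_distrib, Finset.sum_ite_eq', if_pos hi', hc,
      ← mul_assoc, ← mul_pow, altSum_eq_sum]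
    simp
  have hA' : ∑ j ∈ Finset.Icc 1 N, |G' (τ j)| ≤ 2 * A := by
    calc ∑ j ∈ Finset.Icc 1 N, |G' (τ j)|
        ≤ ∑ j ∈ Finset.Icc 1 N, (|G (τ j)| + if j = i then |c| else 0) := by
          refine Finset.sum_le_sum fun j hj => ?_
          simp only [G', hτ j hj]
          split_ifs
          · rw [mul_one]; exact abs_sub _ _
          · simp
      _ = A + |c| := by rw [Finset.sum_add_distrib, Finset.sum_ite_eq', if_pos hi']
      _ ≤ 2 * A := by linarith
  obtain ⟨v, hv⟩ := exists_vertexField_of_altSum_eq_zero hρ hK E G' hsum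
  refine ⟨v + c • X, (hv.add (hX.smul c)).mono ?_ ?_⟩
  · intro u _ σ _
    by_cases h : σ = z
    · simp [vertexData, h, G']
    · simp [vertexData, h]
  · intro u _
    by_cases h : z ∈ u
    · simp only [vertexBound, h, if_true]
      have hA0 : 0 ≤ A := Finset.sum_nonneg fun _ _ => abs_nonneg _
      calc 13 / ρ * (N * ∑ j ∈ Finset.Icc 1 N, |G' (τ j)|) + |c| * (13 / ρ * κ)
          ≤ 13 / ρ * (N * (2 * A)) + A * (13 / ρ * κ) := by gcongr
        _ = 13 / ρ * ((2 * N + κ) * A) := by ring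
    · simp [vertexBound, h]

/-! ### The angle condition -/

lemma bddAbove_abs_sin (K : SimplicialComplex ℝ Plane) (z : Plane) :
    BddAbove ((fun σ : ℝ => |Real.sin σ|) '' angleSums K z) := by
  refine ⟨1, ?_⟩
  rintro _ ⟨σ, -, rfl⟩
  exact Real.abs_sin_le_one σ

/-- Both angles lie strictly between 0 and π, so σ − π lies in (−π, π), where the sine vanishes only
at 0. Thus a pair with σ ≠ π has nonzero sine. -/
lemma Theta_pos {K : SimplicialComplex ℝ Plane} {z : Plane} (hz : 0 < Gam K z) :
    0 < Theta K z := by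
  have hex : ∃ σ ∈ angleSums K z, 0 < |σ - Real.pi| := by
    by_contra! hcon
    refine hz.not_ge (Real.sSup_nonpos ?_)
    rintro _ ⟨σ, hσ, rfl⟩
    exact hcon σ hσ
  obtain ⟨σ, hσ, hpos⟩ := hex
  refine lt_of_lt_of_le ?_ (le_csSup (bddAbove_abs_sin K z) ⟨σ, hσ, rfl⟩)
  obtain ⟨y, a, b, hab, hs, ht, rfl⟩ := hσ
  have hangle : ∀ p q : Plane, signedArea z p q ≠ 0 →
      0 < EuclideanGeometry.angle p z q ∧ EuclideanGeometry.angle p z q < Real.pi := by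
    intro p q h
    have hnc : ¬Collinear ℝ {p, z, q} := by
      intro hc
      apply h
      obtain ⟨v, hv⟩ := (collinear_iff_of_mem (p₀ := z) (by simp)).1 hc
      obtain ⟨r, hr⟩ := hv p (by simp)
      obtain ⟨s, hs⟩ := hv q (by simp)
      rw [hr, hs]
      simp [signedArea]
      ring
    exact ⟨EuclideanGeometry.angle_pos_of_not_collinear hnc,
      EuclideanGeometry.angle_lt_pi_of_not_collinear hnc⟩
  have ha := signedArea_ne_zero hs
  have hb := signedArea_ne_zero ht
  obtain ⟨h1, h2⟩ := hangle a y (by rw [signedArea_swap]; simpa)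
  obtain ⟨h3, h4⟩ := hangle y b hb
  rw [abs_pos] at hpos ⊢
  set σ := EuclideanGeometry.angle a z y + EuclideanGeometry.angle y z b
  intro h0
  apply hpos
  have h5 : Real.sin (σ - Real.pi) = 0 := by rw [Real.sin_sub_pi, h0, neg_zero]
  exact (Real.sin_eq_zero_iff_of_lt_of_lt (by simp only [σ]; linarith)
    (by simp only [σ]; linarith)).1 h5

/-- With finitely many vertices the minimum is attained, hence positive. A pair with |sin| above
`Theta K z / 2` exists by the definition of the supremum, whether or not it is attained; this causes
the factor 2. -/
lemma exists_edge_of_nonsingular {K : SimplicialComplex ℝ Plane} (hf : K.faces.Finite)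
    {z : Plane} (hz : z ∈ nonsingularVertices K) :
    ∃ y a b : Plane, a ≠ b ∧ {z, y, a} ∈ triangles K ∧ {z, y, b} ∈ triangles K ∧
      Real.sin (EuclideanGeometry.angle a z y + EuclideanGeometry.angle y z b) ≠ 0 ∧
      1 / |Real.sin (EuclideanGeometry.angle a z y + EuclideanGeometry.angle y z b)| ≤
        2 * invThetaMin K := by
  have hvert : K.vertices.Finite := by
    refine Set.Finite.preimage (Set.injOn_of_injective Finset.singleton_injective) hf
  have hfin : (Theta K '' nonsingularVertices K).Finite := (hvert.subset fun x hx => hx.1).image _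
  have hne : (nonsingularVertices K).Nonempty := ⟨z, hz⟩
  have hmin : 0 < sInf (Theta K '' nonsingularVertices K) := by
    obtain ⟨x, hx, h⟩ := (hne.image (Theta K)).csInf_mem hfin
    rw [← h]
    exact Theta_pos hx.2
  have hle : sInf (Theta K '' nonsingularVertices K) ≤ Theta K z :=
    csInf_le hfin.bddBelow ⟨z, hz, rfl⟩
  have hpos := Theta_pos hz.2
  have hne' : ((fun σ : ℝ => |Real.sin σ|) '' angleSums K z).Nonempty := by
    by_contra hcon
    rw [Set.not_nonempty_iff_eq_empty] at hcon
    rw [Theta, hcon, Real.sSup_empty] at hpos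
    exact hpos.false
  obtain ⟨_, ⟨σ, ⟨y, a, b, hab, hs, ht, rfl⟩, rfl⟩, hlt⟩ :=
    exists_lt_of_lt_csSup hne' (half_lt_self hpos)
  change Theta K z / 2 < _ at hlt
  refine ⟨y, a, b, hab, hs, ht, ?_, ?_⟩
  · intro h
    simp only [h, abs_zero] at hlt
    linarith
  · rw [invThetaMin, if_pos hne]
    simp only at hlt
    calc _ ≤ 1 / (sInf (Theta K '' nonsingularVertices K) / 2) :=
          one_div_le_one_div_of_le (by positivity) (le_trans (by linarith) hlt.le)
      _ = _ := by field_simp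

/-! ### Consequences of shape regularity -/

lemma volume_real_closedBall (x : Plane) {r : ℝ} (hr : 0 ≤ r) :
    volume.real (Metric.closedBall x r) = r ^ 2 * volume.real (Metric.ball (0 : Plane) 1) := by
  rw [Measure.addHaar_real_closedBall _ _ hr, finrank_euclideanSpace_fin]

lemma volume_real_ball (x : Plane) {r : ℝ} (hr : 0 ≤ r) :
    volume.real (Metric.ball x r) = r ^ 2 * volume.real (Metric.ball (0 : Plane) 1) := by
  rw [measureReal_def, Measure.addHaar_ball _ _ hr, finrank_euclideanSpace_fin, ENNReal.toReal_mul,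
    ENNReal.toReal_ofReal (by positivity), measureReal_def]

lemma volume_real_unitBall_pos : 0 < volume.real (Metric.ball (0 : Plane) 1) :=
  ENNReal.toReal_pos (Metric.measure_ball_pos _ _ one_pos).ne' measure_ball_lt_top.ne

lemma volume_closedTri_ne_top (u : Finset Plane) : volume (closedTri u) ≠ ⊤ :=
  (isCompact_closedTri u).measure_lt_top.ne

lemma volume_openTri_ne_top (u : Finset Plane) : volume (openTri u) ≠ ⊤ :=
  measure_ne_top_of_subset interior_subset (volume_closedTri_ne_top u)

lemma openTri_ae_eq (u : Finset Plane) : openTri u =ᵐ[volume] closedTri u :=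
  interior_ae_eq_of_null_frontier ((convex_convexHull ℝ _).addHaar_frontier volume)

lemma closedTri_subset_closedBall {u : Finset Plane} {z : Plane} (hz : z ∈ u) :
    closedTri u ⊆ Metric.closedBall z (Metric.diam (closedTri u)) := fun _ hx =>
  Metric.dist_le_diam_of_mem (isBounded_closedTri u) hx (subset_convexHull ℝ _ hz)

lemma volume_real_openTri_le {u : Finset Plane} {z : Plane} (hz : z ∈ u) :
    volume.real (openTri u) ≤
      Metric.diam (closedTri u) ^ 2 * volume.real (Metric.ball (0 : Plane) 1) := by
  rw [← volume_real_closedBall z Metric.diam_nonneg]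
  exact measureReal_mono (interior_subset.trans (closedTri_subset_closedBall hz))
    measure_closedBall_lt_top.ne

/-- Near each vertex, a triangle contains a ball of comparable size. -/
lemma exists_ball_subset_openTri {K : SimplicialComplex ℝ Plane} {ρ : ℝ}
    (hK : IsShapeRegular K ρ) {u : Finset Plane} (hu : u ∈ triangles K) {z : Plane} (hz : z ∈ u)
    {r : ℝ} (hr : 0 < r) (hru : r ≤ Metric.diam (closedTri u)) :
    ∃ c, Metric.ball c (ρ * r / 2) ⊆ openTri u ∩ Metric.closedBall z r := by
  obtain ⟨c, R, hb, hR⟩ := hK u hu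
  set h := Metric.diam (closedTri u) with hh
  have hpos : 0 < h := hr.trans_le hru
  have hzu : z ∈ closedTri u := subset_convexHull ℝ _ hz
  -- The ball given by shape regularity is shrunk towards `z` with ratio `r / h`; convexity keeps it
  -- in the triangle.
  have hsub : Metric.ball (z + (r / h) • (c - z)) (ρ * r / 2) ⊆
      closedTri u ∩ Metric.closedBall z r := by
    intro x hx
    have hx' : z + (h / r) • (x - z) ∈ closedTri u := by
      apply hb
      rw [Metric.mem_closedBall, dist_eq_norm]
      rw [Metric.mem_ball, dist_eq_norm] at hx
      have e : z + (h / r) • (x - z) - c = (h / r) • (x - (z + (r / h) • (c - z))) := by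
        rw [← sub_sub, smul_sub _ (x - z), smul_smul, div_mul_div_cancel₀ hr.ne',
          div_self hpos.ne', one_smul]
        abel
      rw [e, norm_smul, Real.norm_of_nonneg (by positivity)]
      calc h / r * ‖x - (z + (r / h) • (c - z))‖ ≤ h / r * (ρ * r / 2) := by gcongr
        _ = ρ * h / 2 := by field_simp
        _ ≤ R := by linarith
    have e : x = z + (r / h) • (z + (h / r) • (x - z) - z) := by
      rw [add_sub_cancel_left, smul_smul, div_mul_div_cancel₀ hpos.ne', div_self hr.ne', one_smul]
      abel
    constructor
    · rw [e]
      exact (convex_convexHull ℝ _).add_smul_sub_mem hzu hx'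
        ⟨by positivity, (div_le_one hpos).2 hru⟩
    · have h1 := closedTri_subset_closedBall hz hx'
      rw [Metric.mem_closedBall, dist_eq_norm, add_sub_cancel_left, norm_smul,
        Real.norm_of_nonneg (by positivity), ← hh] at h1
      rw [Metric.mem_closedBall, dist_eq_norm]
      rw [div_mul_eq_mul_div, div_le_iff₀ hr] at h1
      exact le_of_mul_le_mul_left h1 hpos
  refine ⟨_, subset_inter ?_ (hsub.trans inter_subset_right)⟩
  exact interior_maximal (hsub.trans inter_subset_left) Metric.isOpen_ball

lemma le_volume_real_openTri {K : SimplicialComplex ℝ Plane} {ρ : ℝ} (hρ : 0 < ρ)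
    (hK : IsShapeRegular K ρ) {u : Finset Plane} (hu : u ∈ triangles K) :
    (ρ * Metric.diam (closedTri u) / 2) ^ 2 * volume.real (Metric.ball (0 : Plane) 1) ≤
      volume.real (openTri u) := by
  have hd := diam_closedTri_pos hu
  obtain ⟨z, hz⟩ := Finset.card_pos.1 (by rw [hu.2]; norm_num : 0 < u.card)
  obtain ⟨c, hc⟩ := exists_ball_subset_openTri hK hu hz hd le_rfl
  rw [← volume_real_ball c (by positivity)]
  exact measureReal_mono (hc.trans inter_subset_left) (volume_openTri_ne_top u)

/-- The number of triangles with a common vertex is bounded. -/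
lemma card_mul_sq_le_one {K : SimplicialComplex ℝ Plane} {ρ : ℝ} (hρ : 0 < ρ)
    (hK : IsShapeRegular K ρ) {z : Plane} (S : Finset (Finset Plane))
    (hS : ∀ u ∈ S, u ∈ triangles K ∧ z ∈ u) : (S.card : ℝ) * (ρ / 2) ^ 2 ≤ 1 := by
  rcases S.eq_empty_or_nonempty with rfl | hne
  · simp
  -- With `r` the smallest diameter, each triangle contributes a ball of radius `ρ * r / 2` inside
  -- the ball of radius `r` about `z`. These are disjoint, and comparing areas bounds their number.
  obtain ⟨u₀, hu₀, hmin⟩ := S.exists_min_image (fun u => Metric.diam (closedTri u)) hne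
  set r := Metric.diam (closedTri u₀)
  have hr : 0 < r := diam_closedTri_pos (hS u₀ hu₀).1
  have hex : ∀ u, ∃ c, u ∈ S → Metric.ball c (ρ * r / 2) ⊆ openTri u ∩ Metric.closedBall z r := by
    intro u
    by_cases hu : u ∈ S
    · obtain ⟨c, hc⟩ := exists_ball_subset_openTri hK (hS u hu).1 (hS u hu).2 hr (hmin u hu)
      exact ⟨c, fun _ => hc⟩
    · exact ⟨0, fun h => absurd h hu⟩
  choose c hc using hex
  have hdisj : PairwiseDisjoint (S : Set (Finset Plane))
      fun u => Metric.ball (c u) (ρ * r / 2) := by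
    intro u hu t ht hut
    exact (disjoint_openTri (hS u hu).1 (hS t ht).1 hut).mono
      ((hc u hu).trans inter_subset_left) ((hc t ht).trans inter_subset_left)
  have h1 := measureReal_biUnion_finset (μ := volume) hdisj fun u _ => measurableSet_ball
  have h2 : volume.real (⋃ u ∈ S, Metric.ball (c u) (ρ * r / 2)) ≤
      volume.real (Metric.closedBall z r) := by
    refine measureReal_mono ?_ measure_closedBall_lt_top.ne
    exact iUnion₂_subset fun u hu => (hc u hu).trans inter_subset_right
  rw [h1, volume_real_closedBall z hr.le, Finset.sum_congr rfl fun u _ =>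
    volume_real_ball (c u) (by positivity : 0 ≤ ρ * r / 2), Finset.sum_const, nsmul_eq_mul,
    ← mul_assoc] at h2
  have h3 := le_of_mul_le_mul_right h2 volume_real_unitBall_pos
  have h4 : (S.card : ℝ) * (ρ / 2) ^ 2 * r ^ 2 ≤ 1 * r ^ 2 := by
    calc (S.card : ℝ) * (ρ / 2) ^ 2 * r ^ 2 = S.card * (ρ * r / 2) ^ 2 := by ring
      _ ≤ 1 * r ^ 2 := by linarith
  exact le_of_mul_le_mul_right h4 (by positivity)

/-- The coordinate at `z` drops from 1 to 0 along the edge while its partial derivatives are at most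
1 / (ρ diam), so the edge cannot be short. The 2 counts the two partial derivatives. -/
lemma diam_le_mul_dist {K : SimplicialComplex ℝ Plane} {ρ : ℝ} (hρ : 0 < ρ)
    (hK : IsShapeRegular K ρ) {z y a : Plane} (hs : {z, y, a} ∈ triangles K) :
    Metric.diam (closedTri {z, y, a}) ≤ 2 / ρ * dist z y := by
  have hd := diam_closedTri_pos hs
  have h1 : baryGrad z y a (z - y) = 1 := by
    rw [← bary_sub_bary, bary_self (signedArea_ne_zero hs), bary_left, sub_zero]
  rw [baryGrad_eq_sum] at h1
  have g0 := abs_baryGrad_single_mul_le hρ hK hs 0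
  have g1 := abs_baryGrad_single_mul_le hρ hK hs 1
  set D := ρ * Metric.diam (closedTri {z, y, a}) with hD
  have hDpos : 0 < D := by positivity
  have n0 := abs_coord_le_norm (z - y) 0
  have n1 := abs_coord_le_norm (z - y) 1
  rw [← dist_eq_norm] at n0 n1
  have h2 : 1 ≤ 1 / D * dist z y + 1 / D * dist z y := by
    calc (1 : ℝ) = |baryGrad z y a (EuclideanSpace.single 0 1) * (z - y) 0 +
          baryGrad z y a (EuclideanSpace.single 1 1) * (z - y) 1| := by rw [h1, abs_one]
      _ ≤ |baryGrad z y a (EuclideanSpace.single 0 1)| * |(z - y) 0| +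
          |baryGrad z y a (EuclideanSpace.single 1 1)| * |(z - y) 1| := by
        rw [← abs_mul, ← abs_mul]; exact abs_add_le _ _
      _ ≤ _ := by gcongr
  have h3 : D ≤ 2 * dist z y := by
    have := mul_le_mul_of_nonneg_left h2 hDpos.le
    field_simp at this
    linarith
  rw [div_mul_eq_mul_div, le_div_iff₀ hρ]
  linarith

lemma le_pow_mul_of_chain {f : ℕ → ℝ} {M : ℝ} {N : ℕ} (hM : 1 ≤ M)
    (hpos : ∀ j ∈ Icc 1 N, 0 < f j)
    (h : ∀ j, 1 ≤ j → j < N → f j ≤ M * f (j + 1) ∧ f (j + 1) ≤ M * f j) {i j : ℕ}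
    (hi : i ∈ Icc 1 N) (hj : j ∈ Icc 1 N) : f i ≤ M ^ N * f j := by
  have key : ∀ d m, 1 ≤ m → m + d ≤ N → f m ≤ M ^ d * f (m + d) ∧ f (m + d) ≤ M ^ d * f m := by
    intro d
    induction d with
    | zero => intro m _ _; simp
    | succ d ih =>
      intro m h1 h2
      obtain ⟨a1, a2⟩ := ih m h1 (by omega)
      obtain ⟨b1, b2⟩ := h (m + d) (by omega) (by omega)
      have hMd : 0 ≤ M ^ d := by positivity
      constructor
      · calc f m ≤ M ^ d * f (m + d) := a1
          _ ≤ M ^ d * (M * f (m + d + 1)) := by gcongr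
          _ = M ^ (d + 1) * f (m + (d + 1)) := by rw [pow_succ, mul_assoc, add_assoc]
      · calc f (m + (d + 1)) ≤ M * f (m + d) := b2
          _ ≤ M * (M ^ d * f m) := by gcongr
          _ = M ^ (d + 1) * f m := by rw [pow_succ]; ring
  have hle : ∀ d ≤ N, M ^ d * f j ≤ M ^ N * f j := fun d hd =>
    mul_le_mul_of_nonneg_right (pow_le_pow_right₀ hM hd) (hpos j hj).le
  rcases le_total i j with hij | hij
  · obtain ⟨d, rfl⟩ := Nat.exists_eq_add_of_le hij
    exact ((key d i hi.1 hj.2).1).trans (hle d (by have := hj.2; omega))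
  · obtain ⟨d, rfl⟩ := Nat.exists_eq_add_of_le hij
    exact ((key d j hj.1 hi.2).2).trans (hle d (by have := hi.2; omega))

/-- Triangles with a common vertex have comparable diameters. -/
lemma IsStarEnumeration.diam_le {K : SimplicialComplex ℝ Plane} {ρ : ℝ} (hρ : 0 < ρ)
    (hK : IsShapeRegular K ρ) {z : Plane} {N : ℕ} {τ : ℕ → Finset Plane}
    (E : IsStarEnumeration K z N τ) {u t : Finset Plane} (hu : u ∈ star K z) (ht : t ∈ star K z) :
    Metric.diam (closedTri u) ≤ (2 / ρ + 1) ^ N * Metric.diam (closedTri t) := by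
  obtain ⟨i, hi, rfl⟩ := E.bijOn.surjOn hu
  obtain ⟨j, hj, rfl⟩ := E.bijOn.surjOn ht
  refine le_pow_mul_of_chain (f := fun j => Metric.diam (closedTri (τ j)))
    (by have : 0 < 2 / ρ := by positivity
        linarith) (fun j hj => diam_closedTri_pos (E.bijOn.mapsTo hj).1) ?_ hi hj
  intro j h1 h2
  obtain ⟨y, a, b, hab, ha, hb⟩ := E.exists_edge h1 h2
  have m1 := (E.bijOn.mapsTo (show j ∈ Icc 1 N from ⟨h1, h2.le⟩)).1
  have m2 := (E.bijOn.mapsTo (show j + 1 ∈ Icc 1 N from ⟨by omega, h2⟩)).1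
  rw [ha] at m1 ⊢
  rw [hb] at m2 ⊢
  -- Neighbouring diameters are compared through the length of the common edge.
  have key : ∀ c d, {z, y, c} ∈ triangles K → Metric.diam (closedTri {z, y, c}) ≤
      (2 / ρ + 1) * Metric.diam (closedTri {z, y, d}) := by
    intro c d hc
    refine (diam_le_mul_dist hρ hK hc).trans ?_
    have : dist z y ≤ Metric.diam (closedTri {z, y, d}) := dist_le_diam (by simp) (by simp)
    have h0 : 0 ≤ Metric.diam (closedTri {z, y, d}) := Metric.diam_nonneg
    calc 2 / ρ * dist z y ≤ 2 / ρ * Metric.diam (closedTri {z, y, d}) := by gcongr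
      _ ≤ _ := by rw [add_mul, one_mul]; linarith
  exact ⟨key a b m1, key b a m2⟩

/-! ### The inverse estimate -/

/-- The `k`-th finite difference of `Q` vanishes, which expresses `Q` at 0 through its values at 1,
…, k with binomial coefficients, each at most 2^k. Cauchy–Schwarz gives the factor k · 4^k. -/
lemma sq_eval_zero_le {k : ℕ} (Q : Polynomial ℝ) (hQ : Q.natDegree < k) :
    Q.eval 0 ^ 2 ≤ k * 4 ^ k * ∑ i ∈ Finset.Icc 1 k, Q.eval (i : ℝ) ^ 2 := by
  have h := congr_fun (Polynomial.fwdDiff_iter_eq_zero_of_degree_lt hQ) 0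
  rw [fwdDiff_iter_eq_sum_shift] at h
  simp only [zero_add, nsmul_eq_mul, mul_one, zsmul_eq_mul, Pi.zero_apply] at h
  rw [Finset.range_eq_Ico, Finset.sum_eq_sum_Ico_succ_bot (by omega)] at h
  have hI : Finset.Ico (0 + 1) (k + 1) = Finset.Icc 1 k := rfl
  rw [hI] at h
  push_cast at h
  have h1 : ((-1 : ℝ) ^ k * Q.eval 0) ^ 2 = Q.eval 0 ^ 2 := by
    rw [mul_pow, ← pow_mul, mul_comm k 2, pow_mul]; norm_num
  have h2 : (-1 : ℝ) ^ k * Q.eval 0 =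
      -∑ i ∈ Finset.Icc 1 k, (-1 : ℝ) ^ (k - i) * (k.choose i) * Q.eval (i : ℝ) := by
    simp at h
    linarith
  rw [← h1, h2, neg_sq]
  refine (sq_sum_le_card_mul_sum_sq).trans ?_
  rw [Nat.card_Icc, Nat.add_sub_cancel, mul_assoc]
  refine mul_le_mul_of_nonneg_left ?_ (by positivity)
  rw [Finset.mul_sum]
  refine Finset.sum_le_sum fun i _ => ?_
  rw [mul_pow, mul_pow]
  refine mul_le_mul_of_nonneg_right ?_ (sq_nonneg _)
  have h3 : ((-1 : ℝ) ^ (k - i)) ^ 2 = 1 := by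
    rw [← pow_mul, mul_comm, pow_mul]; norm_num
  have h4 : (k.choose i : ℝ) ≤ 2 ^ k := by exact_mod_cast Nat.choose_le_two_pow k i
  rw [h3, one_mul, show (4 : ℝ) ^ k = (2 ^ k) ^ 2 by rw [← pow_mul, mul_comm, pow_mul]; norm_num]
  gcongr

/-- The function on the plane that belongs to a polynomial in two variables. -/
noncomputable def polyFun (P : MvPolynomial (Fin 2) ℝ) (x : Plane) : ℝ :=
  MvPolynomial.eval (fun i => x i) P

lemma continuous_polyFun (P : MvPolynomial (Fin 2) ℝ) : Continuous (polyFun P) :=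
  (MvPolynomial.continuous_eval P).comp (by fun_prop)

/-- Restrict `P` to the line through `z` and `x`, parametrised so that 0 is `z` and `k` is `x`, and
apply `sq_eval_zero_le`. -/
lemma sq_polyFun_le {k : ℕ} (hk : 1 ≤ k) {P : MvPolynomial (Fin 2) ℝ}
    (hP : P.totalDegree ≤ k - 1) (z x : Plane) :
    polyFun P z ^ 2 ≤ k * 4 ^ k *
      ∑ i ∈ Finset.Icc 1 k, polyFun P (z + ((i : ℝ) / k) • (x - z)) ^ 2 := by
  let f : Fin 2 → Polynomial ℝ := fun i =>
    Polynomial.C (z i) + Polynomial.C ((x i - z i) / k) * Polynomial.X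
  let Q := MvPolynomial.aeval f P
  have hdeg : Q.natDegree < k := by
    have := MvPolynomial.aeval_natDegree_le P hP f (n := 1) (fun i => by
      refine (Polynomial.natDegree_add_le _ _).trans (max_le (by simp) ?_)
      exact Polynomial.natDegree_C_mul_le _ _ |>.trans Polynomial.natDegree_X_le)
    have h2 : Q.natDegree ≤ (k - 1) * 1 := this
    omega
  have heval : ∀ s : ℝ, Q.eval s = polyFun P (z + (s / k) • (x - z)) := by
    intro s
    have h1 : Q.eval s = MvPolynomial.eval (fun i => (f i).eval s) P := by
      have := MvPolynomial.map_aeval f (Polynomial.evalRingHom s) P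
      simp only [Polynomial.coe_evalRingHom] at this
      rw [this]
      rw [MvPolynomial.coe_eval₂Hom, ← MvPolynomial.eval₂_id]
      congr 1
      ext; simp
    rw [h1, polyFun]
    congr 2
    ext i
    simp [f]
    ring
  have := sq_eval_zero_le Q hdeg
  simp only [heval] at this
  simpa using this

/-- The inverse estimate for the value at a vertex of a polynomial on a triangle. -/
lemma volume_mul_sq_polyFun_le {k : ℕ} (hk : 1 ≤ k) {P : MvPolynomial (Fin 2) ℝ}
    (hP : P.totalDegree ≤ k - 1) {u : Finset Plane} {z : Plane} (hz : z ∈ u) :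
    volume.real (openTri u) * polyFun P z ^ 2 ≤
      k ^ 4 * 4 ^ k * ∫ x in openTri u, polyFun P x ^ 2 := by
  have hk0 : (0 : ℝ) < k := by exact_mod_cast hk
  have hint : ∀ g : Plane → ℝ, Continuous g → IntegrableOn g (openTri u) := fun g hg =>
    (hg.continuousOn.integrableOn_compact (isCompact_closedTri u)).mono_set interior_subset
  have hsq : Continuous fun x => polyFun P x ^ 2 := (continuous_polyFun P).pow 2
  have hcont : ∀ i : ℕ, Continuous fun x => polyFun P (z + ((i : ℝ) / k) • (x - z)) ^ 2 :=
    fun i => hsq.comp (by fun_prop)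
  set I := ∫ x in openTri u, polyFun P x ^ 2 with hI
  have hI0 : 0 ≤ I := integral_nonneg fun x => sq_nonneg _
  let F : Plane → ℝ := (openTri u).indicator fun x => polyFun P x ^ 2
  have hF0 : ∀ x, 0 ≤ F x := fun x => indicator_nonneg (fun _ _ => sq_nonneg _) x
  have hFint : Integrable F := (integrable_indicator_iff (measurableSet_openTri u)).2 (hint _ hsq)
  -- Scaling towards `z` with ratio `i / k` maps the triangle into itself; the change of variables
  -- costs `(k / i) ^ 2 ≤ k ^ 2`.
  have hstep : ∀ i ∈ Finset.Icc 1 k,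
      ∫ x in openTri u, polyFun P (z + ((i : ℝ) / k) • (x - z)) ^ 2 ≤ k ^ 2 * I := by
    intro i hi
    rw [Finset.mem_Icc] at hi
    have hi0 : (1 : ℝ) ≤ i := by exact_mod_cast hi.1
    have hik : (i : ℝ) ≤ k := by exact_mod_cast hi.2
    set l : ℝ := (i : ℝ) / k with hl
    have hl0 : 0 < l := by positivity
    have hFl : Integrable fun x => F (z + l • (x - z)) :=
      ((hFint.comp_add_left z).comp_smul hl0.ne').comp_sub_right z
    calc ∫ x in openTri u, polyFun P (z + l • (x - z)) ^ 2
        = ∫ x in openTri u, F (z + l • (x - z)) := by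
          refine setIntegral_congr_fun (measurableSet_openTri u) fun x hx => ?_
          have hmem : z + l • (x - z) ∈ openTri u :=
            (convex_convexHull ℝ _).add_smul_sub_mem_interior'
              (subset_closure (subset_convexHull ℝ _ hz)) hx ⟨hl0, (div_le_one hk0).2 hik⟩
          simp only [F, indicator_of_mem hmem]
      _ ≤ ∫ x, F (z + l • (x - z)) :=
          setIntegral_le_integral hFl (ae_of_all _ fun x => hF0 _)
      _ = ∫ x, F (z + l • x) := integral_sub_right_eq_self (fun x => F (z + l • x)) z
      _ = |(l ^ 2)⁻¹| * ∫ x, F (z + x) := by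
          rw [Measure.integral_comp_smul volume (fun x => F (z + x)) l, finrank_euclideanSpace_fin,
            smul_eq_mul]
      _ = (l ^ 2)⁻¹ * I := by
          rw [integral_add_left_eq_self F z, integral_indicator (measurableSet_openTri u),
            abs_of_nonneg (by positivity)]
      _ ≤ k ^ 2 * I := by
          refine mul_le_mul_of_nonneg_right ?_ hI0
          rw [hl, div_pow, inv_div]
          exact div_le_self (by positivity) (one_le_pow₀ hi0)
  calc volume.real (openTri u) * polyFun P z ^ 2
      = ∫ _ in openTri u, polyFun P z ^ 2 := by rw [setIntegral_const, smul_eq_mul]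
    _ ≤ ∫ x in openTri u, k * 4 ^ k *
          ∑ i ∈ Finset.Icc 1 k, polyFun P (z + ((i : ℝ) / k) • (x - z)) ^ 2 := by
        refine setIntegral_mono_on (hint _ continuous_const) (hint _ ?_)
          (measurableSet_openTri u) fun x _ => sq_polyFun_le hk hP z x
        exact continuous_const.mul (continuous_finsetSum _ fun i _ => hcont i)
    _ = k * 4 ^ k * ∑ i ∈ Finset.Icc 1 k,
          ∫ x in openTri u, polyFun P (z + ((i : ℝ) / k) • (x - z)) ^ 2 := by
        rw [integral_const_mul, integral_finsetSum _ fun i _ => hint _ (hcont i)]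
    _ ≤ k * 4 ^ k * ∑ i ∈ Finset.Icc 1 k, k ^ 2 * I := by
        gcongr with i hi
        exact hstep i hi
    _ = k ^ 4 * 4 ^ k * I := by
        rw [Finset.sum_const, Nat.card_Icc, Nat.add_sub_cancel, nsmul_eq_mul]; ring

/-! ### Estimates in `L²` -/

lemma normL2_sq (K : SimplicialComplex ℝ Plane) (f : Plane → ℝ) :
    normL2 K f ^ 2 = ∫⁻ x in domain K, ENNReal.ofReal (f x ^ 2) := by
  have h := eLpNorm_nnreal_pow_eq_lintegral (f := f) (μ := volume.restrict (domain K))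
    (p := 2) two_ne_zero
  simp only [NNReal.coe_ofNat, ENNReal.coe_ofNat, ENNReal.rpow_ofNat] at h
  rw [normL2, h]
  refine lintegral_congr fun x => ?_
  rw [Real.enorm_eq_ofReal_abs, ← ENNReal.ofReal_pow (abs_nonneg _), sq_abs]

lemma IsTriangulation.finite_triangles {K : SimplicialComplex ℝ Plane} (hT : IsTriangulation K) :
    (triangles K).Finite := hT.finite.subset fun _ h => h.1

lemma IsTriangulation.finite_vertices {K : SimplicialComplex ℝ Plane} (hT : IsTriangulation K) :
    K.vertices.Finite :=
  Set.Finite.preimage (Set.injOn_of_injective Finset.singleton_injective) hT.finite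

lemma mem_vertices_of_mem {K : SimplicialComplex ℝ Plane} {u : Finset Plane}
    (hu : u ∈ triangles K) {z : Plane} (hz : z ∈ u) : z ∈ K.vertices :=
  K.down_closed hu.1 (Finset.singleton_subset_iff.2 hz) (Finset.singleton_nonempty z)

lemma openTri_subset_domain {K : SimplicialComplex ℝ Plane} {u : Finset Plane}
    (hu : u ∈ triangles K) : openTri u ⊆ domain K :=
  interior_mono (SimplicialComplex.convexHull_subset_space hu.1)

lemma IsTriangulation.domain_subset {K : SimplicialComplex ℝ Plane} (hT : IsTriangulation K) :
    domain K ⊆ ⋃ u ∈ hT.finite_triangles.toFinset, closedTri u := by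
  intro x hx
  obtain ⟨s, hs, hxs⟩ := SimplicialComplex.mem_space_iff.1 (interior_subset hx)
  obtain ⟨t, ht, hst⟩ := hT.pure s hs
  simp only [mem_iUnion, Set.Finite.mem_toFinset]
  exact ⟨t, ht, convexHull_mono (Finset.coe_subset.2 hst) hxs⟩

lemma sq_gradNorm_le {v : Plane → Plane} {x : Plane} {B : ℝ}
    (h : ∀ i j, |partialDeriv v j i x| ≤ B) : gradNorm v x ^ 2 ≤ 4 * B ^ 2 := by
  rw [gradNorm, Real.sq_sqrt (Finset.sum_nonneg fun _ _ => Finset.sum_nonneg fun _ _ => sq_nonneg _)]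
  have h' : ∀ i j, partialDeriv v j i x ^ 2 ≤ B ^ 2 := fun i j =>
    sq_le_sq' (neg_le_of_abs_le (h i j)) (le_of_abs_le (h i j))
  simp only [Fin.sum_univ_two]
  linarith [h' 0 0, h' 0 1, h' 1 0, h' 1 1]

/-- The closed triangles cover the domain and their boundaries are null sets, so bounds on the open
triangles suffice. The 4 counts the partial derivatives. -/
lemma HasDivData.normL2_gradNorm_sq_le {K : SimplicialComplex ℝ Plane} (hT : IsTriangulation K)
    {v : Plane → Plane} {d : Finset Plane → Plane → ℝ} {B : Finset Plane → ℝ}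
    (h : HasDivData K v d B) : normL2 K (gradNorm v) ^ 2 ≤
      ENNReal.ofReal (∑ u ∈ hT.finite_triangles.toFinset,
        volume.real (openTri u) * (4 * B u ^ 2)) := by
  rw [normL2_sq]
  calc ∫⁻ x in domain K, ENNReal.ofReal (gradNorm v x ^ 2)
      ≤ ∫⁻ x in ⋃ u ∈ hT.finite_triangles.toFinset, closedTri u,
          ENNReal.ofReal (gradNorm v x ^ 2) := lintegral_mono_set hT.domain_subset
    _ ≤ ∑ u ∈ hT.finite_triangles.toFinset,
          ∫⁻ x in closedTri u, ENNReal.ofReal (gradNorm v x ^ 2) := by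
        induction hT.finite_triangles.toFinset using Finset.induction_on with
        | empty => simp
        | insert u I hu ih =>
          rw [Finset.set_biUnion_insert, Finset.sum_insert hu]
          exact (lintegral_union_le _ _ _).trans (by gcongr)
    _ ≤ ∑ u ∈ hT.finite_triangles.toFinset,
          ENNReal.ofReal (volume.real (openTri u) * (4 * B u ^ 2)) := by
        refine Finset.sum_le_sum fun u hu => ?_
        rw [Set.Finite.mem_toFinset] at hu
        rw [← setLIntegral_congr (openTri_ae_eq u)]
        calc ∫⁻ x in openTri u, ENNReal.ofReal (gradNorm v x ^ 2)
            ≤ ∫⁻ _ in openTri u, ENNReal.ofReal (4 * B u ^ 2) :=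
              setLIntegral_mono' (measurableSet_openTri u) fun x hx =>
                ENNReal.ofReal_le_ofReal (sq_gradNorm_le ((h.tri u hu).bound x hx))
          _ = _ := by
            rw [setLIntegral_const, mul_comm, ENNReal.ofReal_mul measureReal_nonneg,
              ofReal_measureReal (volume_openTri_ne_top u)]
    _ = _ := by
        rw [ENNReal.ofReal_sum_of_nonneg fun u _ => by positivity]

lemma sum_integral_sq_le {K : SimplicialComplex ℝ Plane} (hT : IsTriangulation K) {p : Plane → ℝ}
    {P : Finset Plane → MvPolynomial (Fin 2) ℝ}
    (hP : ∀ u ∈ triangles K, ∀ x ∈ openTri u, p x = polyFun (P u) x) :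
    ENNReal.ofReal (∑ u ∈ hT.finite_triangles.toFinset, ∫ x in openTri u, polyFun (P u) x ^ 2) ≤
      normL2 K p ^ 2 := by
  rw [ENNReal.ofReal_sum_of_nonneg fun u _ => integral_nonneg fun _ => sq_nonneg _]
  calc ∑ u ∈ hT.finite_triangles.toFinset,
        ENNReal.ofReal (∫ x in openTri u, polyFun (P u) x ^ 2)
      = ∑ u ∈ hT.finite_triangles.toFinset, ∫⁻ x in openTri u, ENNReal.ofReal (p x ^ 2) := by
        refine Finset.sum_congr rfl fun u hu => ?_
        rw [Set.Finite.mem_toFinset] at hu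
        rw [ofReal_integral_eq_lintegral_ofReal _ (ae_of_all _ fun _ => sq_nonneg _)]
        · exact setLIntegral_congr_fun (measurableSet_openTri u) fun x hx => by
            simp only [hP u hu x hx]
        · exact (((continuous_polyFun (P u)).pow 2).continuousOn.integrableOn_compact
            (isCompact_closedTri u)).mono_set interior_subset
    _ = ∫⁻ x in ⋃ u ∈ hT.finite_triangles.toFinset, openTri u, ENNReal.ofReal (p x ^ 2) := by
        refine (lintegral_biUnion_finset ?_ (fun u _ => measurableSet_openTri u) _).symm
        intro u hu t ht hut
        simp only [Set.Finite.coe_toFinset] at hu ht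
        exact disjoint_openTri hu ht hut
    _ ≤ ∫⁻ x in domain K, ENNReal.ofReal (p x ^ 2) := by
        refine lintegral_mono_set (iUnion₂_subset fun u hu => ?_)
        rw [Set.Finite.mem_toFinset] at hu
        exact openTri_subset_domain hu
    _ = normL2 K p ^ 2 := (normL2_sq K p).symm

lemma sum_sum_eq_sum_biUnion {α : Type*} [DecidableEq α] (T : Finset (Finset α))
    (f : α → Finset α → ℝ) :
    ∑ u ∈ T, ∑ z ∈ u, f z u = ∑ z ∈ T.biUnion id, ∑ u ∈ T with z ∈ u, f z u := by
  refine Finset.sum_comm' fun u z => ?_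
  simp only [Finset.mem_filter, Finset.mem_biUnion, id]
  exact ⟨fun h => ⟨h, u, h⟩, fun h => h.1⟩

/-- The local estimates add up, since only boundedly many triangles share a vertex. -/
lemma sum_mul_sq_sum_le {α : Type*} [DecidableEq α] {T : Finset (Finset α)} {N C : ℝ}
    {m I : Finset α → ℝ} {g : α → Finset α → ℝ} (hm : ∀ u, 0 ≤ m u) (hI : ∀ t, 0 ≤ I t)
    (hN0 : 0 ≤ N) (hC : 0 ≤ C) (h3 : ∀ u ∈ T, u.card = 3)
    (hN : ∀ z, (({u ∈ T | z ∈ u} : Finset (Finset α)).card : ℝ) ≤ N)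
    (hg : ∀ u ∈ T, ∀ t ∈ T, ∀ z ∈ u, z ∈ t → m u * g z t ^ 2 ≤ C * I t) :
    ∑ u ∈ T, m u * (∑ z ∈ u, ∑ t ∈ T with z ∈ t, |g z t|) ^ 2 ≤
      9 * N ^ 2 * C * ∑ t ∈ T, I t := by
  have h1 : ∀ u ∈ T, m u * (∑ z ∈ u, ∑ t ∈ T with z ∈ t, |g z t|) ^ 2 ≤
      3 * N * C * ∑ z ∈ u, ∑ t ∈ T with z ∈ t, I t := by
    intro u hu
    -- Cauchy–Schwarz twice: over the three vertices of `u`, then over the at most `N` triangles at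
    -- each.
    have a1 : (∑ z ∈ u, ∑ t ∈ T with z ∈ t, |g z t|) ^ 2 ≤
        3 * ∑ z ∈ u, (N * ∑ t ∈ T with z ∈ t, g z t ^ 2) := by
      refine (sq_sum_le_card_mul_sum_sq).trans ?_
      rw [h3 u hu]
      push_cast
      gcongr with z hz
      refine (sq_sum_le_card_mul_sum_sq).trans ?_
      simp only [sq_abs]
      exact mul_le_mul_of_nonneg_right (hN z) (Finset.sum_nonneg fun _ _ => sq_nonneg _)
    calc m u * (∑ z ∈ u, ∑ t ∈ T with z ∈ t, |g z t|) ^ 2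
        ≤ m u * (3 * ∑ z ∈ u, (N * ∑ t ∈ T with z ∈ t, g z t ^ 2)) :=
          mul_le_mul_of_nonneg_left a1 (hm u)
      _ = 3 * N * ∑ z ∈ u, ∑ t ∈ T with z ∈ t, m u * g z t ^ 2 := by
          simp only [← Finset.mul_sum]; ring
      _ ≤ 3 * N * ∑ z ∈ u, ∑ t ∈ T with z ∈ t, C * I t := by
          refine mul_le_mul_of_nonneg_left (Finset.sum_le_sum fun z hz =>
            Finset.sum_le_sum fun t ht => ?_) (by positivity)
          rw [Finset.mem_filter] at ht
          exact hg u hu t ht.1 z hz ht.2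
      _ = 3 * N * C * ∑ z ∈ u, ∑ t ∈ T with z ∈ t, I t := by
          simp only [← Finset.mul_sum]; ring
  refine (Finset.sum_le_sum h1).trans ?_
  rw [← Finset.mul_sum]
  -- Double counting: `I t` occurs once for each of the three vertices of `t` and each of the at
  -- most `N` triangles `u` there.
  have h2 : ∑ u ∈ T, ∑ z ∈ u, ∑ t ∈ T with z ∈ t, I t ≤ N * (3 * ∑ t ∈ T, I t) := by
    rw [sum_sum_eq_sum_biUnion T fun z _ => ∑ t ∈ T with z ∈ t, I t]
    calc ∑ z ∈ T.biUnion id, ∑ u ∈ T with z ∈ u, ∑ t ∈ T with z ∈ t, I t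
        ≤ ∑ z ∈ T.biUnion id, N * ∑ t ∈ T with z ∈ t, I t := by
          refine Finset.sum_le_sum fun z _ => ?_
          rw [Finset.sum_const, nsmul_eq_mul]
          exact mul_le_mul_of_nonneg_right (hN z) (Finset.sum_nonneg fun t _ => hI t)
      _ = N * ∑ t ∈ T, ∑ z ∈ t, I t := by
          rw [← Finset.mul_sum, sum_sum_eq_sum_biUnion T fun _ t => I t]
      _ = N * (3 * ∑ t ∈ T, I t) := by
          congr 1
          rw [Finset.mul_sum]
          refine Finset.sum_congr rfl fun t ht => ?_
          rw [Finset.sum_const, h3 t ht, nsmul_eq_mul]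
          norm_num
  calc 3 * N * C * ∑ u ∈ T, ∑ z ∈ u, ∑ t ∈ T with z ∈ t, I t
      ≤ 3 * N * C * (N * (3 * ∑ t ∈ T, I t)) := by gcongr
    _ = 9 * N ^ 2 * C * ∑ t ∈ T, I t := by ring

/-- Triangles with a common vertex have comparable areas. -/
lemma IsStarEnumeration.volume_le {K : SimplicialComplex ℝ Plane} {ρ : ℝ} (hρ : 0 < ρ)
    (hK : IsShapeRegular K ρ) {z : Plane} {N N₀ : ℕ} {τ : ℕ → Finset Plane}
    (E : IsStarEnumeration K z N τ) (hN : N ≤ N₀) {u t : Finset Plane} (hu : u ∈ star K z)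
    (ht : t ∈ star K z) :
    volume.real (openTri u) ≤ ((2 / ρ + 1) ^ N₀ * (2 / ρ)) ^ 2 * volume.real (openTri t) := by
  have h1 := E.diam_le hρ hK hu ht
  have h2 := volume_real_openTri_le hu.2
  have h3 := le_volume_real_openTri hρ hK ht.1
  have hM : (1 : ℝ) ≤ 2 / ρ + 1 := by
    have : 0 < 2 / ρ := by positivity
    linarith
  have hd : 0 ≤ Metric.diam (closedTri t) := Metric.diam_nonneg
  have hω := volume_real_unitBall_pos
  calc volume.real (openTri u)
      ≤ Metric.diam (closedTri u) ^ 2 * volume.real (Metric.ball (0 : Plane) 1) := h2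
    _ ≤ ((2 / ρ + 1) ^ N₀ * Metric.diam (closedTri t)) ^ 2 *
          volume.real (Metric.ball (0 : Plane) 1) := by
        have : Metric.diam (closedTri u) ≤ (2 / ρ + 1) ^ N₀ * Metric.diam (closedTri t) :=
          h1.trans (mul_le_mul_of_nonneg_right (pow_le_pow_right₀ hM hN) hd)
        have h0 : 0 ≤ Metric.diam (closedTri u) := Metric.diam_nonneg
        gcongr
    _ = ((2 / ρ + 1) ^ N₀ * (2 / ρ)) ^ 2 * ((ρ * Metric.diam (closedTri t) / 2) ^ 2 *
          volume.real (Metric.ball (0 : Plane) 1)) := by field_simp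
    _ ≤ _ := by gcongr

/-! ### The vertex values of a pressure -/

lemma mem_closure_openTri {K : SimplicialComplex ℝ Plane} {u : Finset Plane}
    (hu : u ∈ triangles K) {z : Plane} (hz : z ∈ u) : z ∈ closure (openTri u) := by
  have h := (convex_convexHull ℝ (u : Set Plane)).closure_interior_eq_closure_of_nonempty_interior
    (openTri_nonempty hu)
  rw [openTri, closedTri, h]
  exact subset_closure (subset_convexHull ℝ _ hz)

lemma tendsto_of_eq_polyFun {p : Plane → ℝ} {P : MvPolynomial (Fin 2) ℝ} {u : Finset Plane}
    (h : ∀ x ∈ openTri u, p x = polyFun P x) (z : Plane) :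
    Tendsto p (𝓝[openTri u] z) (𝓝 (polyFun P z)) := by
  refine (((continuous_polyFun P).tendsto z).mono_left nhdsWithin_le_nhds).congr' ?_
  filter_upwards [self_mem_nhdsWithin] with x hx
  exact (h x hx).symm

lemma vertexValue_eq {K : SimplicialComplex ℝ Plane} {p : Plane → ℝ}
    {P : MvPolynomial (Fin 2) ℝ} {u : Finset Plane} (hu : u ∈ triangles K)
    (h : ∀ x ∈ openTri u, p x = polyFun P x) {z : Plane} (hz : z ∈ u) :
    vertexValue p u z = polyFun P z :=
  extendFrom_eq (mem_closure_openTri hu hz) (tendsto_of_eq_polyFun h z)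

lemma invThetaMin_nonneg (K : SimplicialComplex ℝ Plane) : 0 ≤ invThetaMin K := by
  rw [invThetaMin]
  split_ifs
  · refine one_div_nonneg.2 (Real.sInf_nonneg ?_)
    rintro _ ⟨z, -, rfl⟩
    refine Real.sSup_nonneg ?_
    rintro _ ⟨σ, -, rfl⟩
    exact abs_nonneg _
  · exact le_rfl

lemma Gam_nonneg (K : SimplicialComplex ℝ Plane) (z : Plane) : 0 ≤ Gam K z := by
  refine Real.sSup_nonneg ?_
  rintro _ ⟨σ, -, rfl⟩
  exact abs_nonneg _

lemma IsStarEnumeration.image_eq {K : SimplicialComplex ℝ Plane} (hT : IsTriangulation K)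
    {z : Plane} {N : ℕ} {τ : ℕ → Finset Plane} (E : IsStarEnumeration K z N τ) :
    (Finset.Icc 1 N).image τ = {u ∈ hT.finite_triangles.toFinset | z ∈ u} := by
  ext u
  have h := Set.ext_iff.1 E.bijOn.image_eq u
  simp only [Set.mem_image, Set.mem_Icc] at h
  simp only [Finset.mem_image, Finset.mem_Icc, Finset.mem_filter, Set.Finite.mem_toFinset]
  exact h

lemma IsStarEnumeration.injOn {K : SimplicialComplex ℝ Plane}
    {z : Plane} {N : ℕ} {τ : ℕ → Finset Plane} (E : IsStarEnumeration K z N τ) :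
    Set.InjOn τ (Finset.Icc 1 N) := by
  rw [Finset.coe_Icc]
  exact E.bijOn.injOn

lemma IsStarEnumeration.sum_eq {K : SimplicialComplex ℝ Plane} (hT : IsTriangulation K)
    {z : Plane} {N : ℕ} {τ : ℕ → Finset Plane} (E : IsStarEnumeration K z N τ)
    (f : Finset Plane → ℝ) :
    ∑ j ∈ Finset.Icc 1 N, f (τ j) = ∑ u ∈ hT.finite_triangles.toFinset with z ∈ u, f u := by
  rw [← E.image_eq hT, Finset.sum_image E.injOn]

lemma IsStarEnumeration.card_eq {K : SimplicialComplex ℝ Plane} (hT : IsTriangulation K)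
    {z : Plane} {N : ℕ} {τ : ℕ → Finset Plane} (E : IsStarEnumeration K z N τ) :
    ({u ∈ hT.finite_triangles.toFinset | z ∈ u} : Finset (Finset Plane)).card = N := by
  rw [← E.image_eq hT, Finset.card_image_of_injOn E.injOn, Nat.card_Icc, Nat.add_sub_cancel]

/-- A bound for the number of triangles with a common vertex. -/
noncomputable def starBound (ρ : ℝ) : ℕ := ⌈4 / ρ ^ 2⌉₊

lemma card_star_le {K : SimplicialComplex ℝ Plane} (hT : IsTriangulation K) {ρ : ℝ} (hρ : 0 < ρ)
    (hK : IsShapeRegular K ρ) (z : Plane) :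
    ({u ∈ hT.finite_triangles.toFinset | z ∈ u} : Finset (Finset Plane)).card ≤ starBound ρ := by
  have h := card_mul_sq_le_one hρ hK (z := z) {u ∈ hT.finite_triangles.toFinset | z ∈ u}
    (fun u hu => by simpa using hu)
  have h2 : (({u ∈ hT.finite_triangles.toFinset | z ∈ u} : Finset (Finset Plane)).card : ℝ) ≤
      4 / ρ ^ 2 := by
    rw [le_div_iff₀ (by positivity)]
    linarith
  exact_mod_cast h2.trans (Nat.le_ceil _)

/-- The field that takes care of the vertex `z`. -/
lemma exists_vertexField {K : SimplicialComplex ℝ Plane} (hT : IsTriangulation K) {ρ : ℝ}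
    (hρ : 0 < ρ) (hK : IsShapeRegular K ρ) {p : Plane → ℝ} {k : ℕ} (hp : p ∈ pressureSpace K k)
    {P : Finset Plane → MvPolynomial (Fin 2) ℝ}
    (hP : ∀ u ∈ triangles K, ∀ x ∈ openTri u, p x = polyFun (P u) x) {z : Plane}
    (hz : z ∈ K.vertices) :
    ∃ v, HasDivData K v (vertexData z fun u => polyFun (P u) z)
      (vertexBound z (13 / ρ * (2 * starBound ρ + 2) * (invThetaMin K + 1) *
        ∑ u ∈ hT.finite_triangles.toFinset with z ∈ u, |polyFun (P u) z|)) := by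
  obtain ⟨N, τ, E⟩ := hT.fan z hz
  have hN : (N : ℝ) ≤ starBound ρ := by
    rw [← E.card_eq hT]
    exact_mod_cast card_star_le hT hρ hK z
  have hθ := invThetaMin_nonneg K
  have hsum := E.sum_eq hT fun u => |polyFun (P u) z|
  set A := ∑ u ∈ hT.finite_triangles.toFinset with z ∈ u, |polyFun (P u) z|
  have hA : 0 ≤ A := Finset.sum_nonneg fun _ _ => abs_nonneg _
  have hmono : ∀ {B B' : ℝ} {v : Plane → Plane}, B ≤ B' →
      HasDivData K v (vertexData z fun u => polyFun (P u) z) (vertexBound z B) →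
      HasDivData K v (vertexData z fun u => polyFun (P u) z) (vertexBound z B') := by
    intro B B' v hB h
    refine h.mono (fun _ _ _ _ => rfl) fun u _ => ?_
    unfold vertexBound
    split_ifs
    · exact hB
    · exact le_rfl
  -- One constant dominating both cases: `N` at singular vertices, and `2 * N + κ` with `κ = 2 *
  -- invThetaMin K` at the others.
  have hmul : (starBound ρ : ℝ) ≤ (2 * starBound ρ + 2) * (invThetaMin K + 1) ∧
      2 * (starBound ρ : ℝ) + 2 * invThetaMin K ≤
        (2 * starBound ρ + 2) * (invThetaMin K + 1) := by
    have : 0 ≤ (starBound ρ : ℝ) * invThetaMin K := by positivity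
    have : 0 ≤ (starBound ρ : ℝ) := by positivity
    constructor <;> nlinarith
  rcases (Gam_nonneg K z).eq_or_lt with h0 | hpos
  · have hs := hp.2.2.2 z ⟨hz, h0.symm⟩ N τ E
    have halt : altSum (fun j => polyFun (P (τ j)) z) N = 0 := by
      rw [altSum_eq_sum, ← hs]
      refine Finset.sum_congr rfl fun j hj => ?_
      have hmem := E.bijOn.mapsTo (Finset.mem_Icc.1 hj)
      rw [vertexValue_eq hmem.1 (hP _ hmem.1) hmem.2]
    obtain ⟨v, hv⟩ := exists_vertexField_of_altSum_eq_zero hρ hK E (fun u => polyFun (P u) z) halt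
    rw [hsum] at hv
    refine ⟨v, hmono ?_ hv⟩
    rw [mul_assoc (13 / ρ), mul_assoc (13 / ρ)]
    gcongr
    exact hN.trans hmul.1
  · obtain ⟨y, a, b, hab, hs, ht, hsin, hκ⟩ := exists_edge_of_nonsingular hT.finite ⟨hz, hpos⟩
    obtain ⟨v, hv⟩ := exists_vertexField_of_sin_ne_zero hρ hK E (fun u => polyFun (P u) z)
      hs ht hab hsin hκ
    rw [hsum] at hv
    refine ⟨v, hmono ?_ hv⟩
    rw [mul_assoc (13 / ρ), mul_assoc (13 / ρ)]
    gcongr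
    linarith [hmul.2]

end ScottVogelius

/-! ### Assembly of the field and the global estimate. -/

open ScottVogelius in
theorem lemma3p5 (ρ : ℝ) (hρ : 0 < ρ) (k : ℕ) (hk : 1 ≤ k) :
    ∃ C₁ : ℝ, 0 < C₁ ∧
      ∀ K : Geometry.SimplicialComplex ℝ ScottVogelius.Plane,
        ScottVogelius.IsTriangulation K → ScottVogelius.IsShapeRegular K ρ →
        ∀ p ∈ ScottVogelius.pressureSpace K (k - 1),
          ∃ v ∈ ScottVogelius.velocitySpace K 4,
            (∀ z ∈ K.vertices, ∀ s ∈ ScottVogelius.star K z,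
              Tendsto (fun x => ScottVogelius.divergence v x - p x)
                (𝓝[ScottVogelius.openTri s] z) (𝓝 0)) ∧
            (∀ s ∈ ScottVogelius.triangles K,
              ∫ x in ScottVogelius.closedTri s, ScottVogelius.divergence v x = 0) ∧
            ScottVogelius.normL2 K (ScottVogelius.gradNorm v) ≤
              ENNReal.ofReal (C₁ * (ScottVogelius.invThetaMin K + 1)) *
                ScottVogelius.normL2 K p := by
  classical
  -- The area ratio of triangles sharing a vertex, times the constant of the inverse estimate.
  set C : ℝ := ((2 / ρ + 1) ^ starBound ρ * (2 / ρ)) ^ 2 * (k ^ 4 * 4 ^ k) with hC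
  have hk0 : (0 : ℝ) < k := by exact_mod_cast hk
  have hCpos : 0 < C := by positivity
  have hN0 : (0 : ℝ) < starBound ρ := by
    have : 0 < starBound ρ := Nat.ceil_pos.2 (by positivity)
    exact_mod_cast this
  -- With `D` as below, `C₁ * (invThetaMin K + 1)` is the square root of `4 * D ^ 2 * (9 * starBound
  -- ρ ^ 2 * C)`: the 4 comes from the gradient norm, the rest from `sum_mul_sq_sum_le`.
  refine ⟨6 * starBound ρ * √C * (13 / ρ * (2 * starBound ρ + 2)), by positivity, ?_⟩
  intro K hT hK p hp
  have hex : ∀ u, ∃ Q : MvPolynomial (Fin 2) ℝ, u ∈ triangles K →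
      Q.totalDegree ≤ k - 1 ∧ ∀ x ∈ openTri u, p x = polyFun Q x := by
    intro u
    by_cases hu : u ∈ triangles K
    · obtain ⟨Q, hQ⟩ := hp.2.2.1 u hu
      exact ⟨Q, fun _ => hQ⟩
    · exact ⟨0, fun h => absurd h hu⟩
  choose P hP using hex
  have hP2 : ∀ u ∈ triangles K, ∀ x ∈ openTri u, p x = polyFun (P u) x := fun u hu => (hP u hu).2
  set T := hT.finite_triangles.toFinset with hTdef
  have hTmem : ∀ u, u ∈ T ↔ u ∈ triangles K := fun u => Set.Finite.mem_toFinset _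
  set D : ℝ := 13 / ρ * (2 * starBound ρ + 2) * (invThetaMin K + 1) with hD
  have hV : ∀ z, ∃ v, z ∈ K.vertices → HasDivData K v (vertexData z fun u => polyFun (P u) z)
      (vertexBound z (D * ∑ u ∈ T with z ∈ u, |polyFun (P u) z|)) := by
    intro z
    by_cases hz : z ∈ K.vertices
    · obtain ⟨v, hv⟩ := exists_vertexField hT hρ hK hp hP2 hz
      exact ⟨v, fun _ => hv⟩
    · exact ⟨0, fun h => absurd h hz⟩
  choose V hV using hV
  set W := hT.finite_vertices.toFinset with hW
  have hWmem : ∀ z, z ∈ W ↔ z ∈ K.vertices := fun z => Set.Finite.mem_toFinset _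
  -- At a vertex σ only the field of σ contributes to the divergence, and on a triangle only the
  -- fields of its own vertices contribute to the bound.
  have hdata := (HasDivData.sum W fun z hz => hV z ((hWmem z).1 hz)).mono
    (d' := fun u σ => polyFun (P u) σ)
    (B' := fun u => ∑ z ∈ u, D * ∑ t ∈ T with z ∈ t, |polyFun (P t) z|)
    (fun u hu σ hσ => by
      have hσW : σ ∈ W := (hWmem σ).2 (mem_vertices_of_mem hu hσ)
      simp only [vertexData]
      rw [Finset.sum_ite_eq, if_pos hσW])
    (fun u hu => by
      simp only [vertexBound]
      rw [Finset.sum_ite_mem, Finset.inter_eq_right.2 fun z hz =>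
        (hWmem z).2 (mem_vertices_of_mem hu hz)])
  set v := ∑ z ∈ W, V z
  refine ⟨v, hdata.mem_velocitySpace, ?_, ?_, ?_⟩
  · rintro z - s ⟨hs, hzs⟩
    have h1 := ((hdata.tri s hs).lim z hzs).sub (tendsto_of_eq_polyFun (hP2 s hs) z)
    rwa [sub_self] at h1
  · intro s hs
    rw [← setIntegral_congr_set (openTri_ae_eq s)]
    exact (hdata.tri s hs).mean
  · rw [← ENNReal.pow_le_pow_left_iff two_ne_zero, mul_pow]
    refine (hdata.normL2_gradNorm_sq_le hT).trans ?_
    refine le_trans ?_ (mul_le_mul_right (sum_integral_sq_le hT hP2) _)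
    have hθ := invThetaMin_nonneg K
    rw [← ENNReal.ofReal_pow (by positivity), ← ENNReal.ofReal_mul (by positivity)]
    refine ENNReal.ofReal_le_ofReal ?_
    have key := sum_mul_sq_sum_le (T := T) (N := starBound ρ) (C := C)
      (m := fun u => volume.real (openTri u))
      (I := fun t => ∫ x in openTri t, polyFun (P t) x ^ 2)
      (g := fun z t => polyFun (P t) z) (fun _ => measureReal_nonneg)
      (fun _ => integral_nonneg fun _ => sq_nonneg _) hN0.le hCpos.le
      (fun u hu => ((hTmem u).1 hu).2)
      (fun z => by exact_mod_cast card_star_le hT hρ hK z) (by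
        intro u hu t ht z hzu hzt
        rw [hTmem] at hu ht
        obtain ⟨N, τ, E⟩ := hT.fan z (mem_vertices_of_mem hu hzu)
        have hN : N ≤ starBound ρ := by
          rw [← E.card_eq hT]
          exact card_star_le hT hρ hK z
        have h1 := E.volume_le hρ hK hN (u := u) (t := t) ⟨hu, hzu⟩ ⟨ht, hzt⟩
        have h2 := volume_mul_sq_polyFun_le hk (hP t ht).1 hzt
        -- The area of `u` is replaced by that of `t`, after which the inverse estimate on `t`
        -- applies.
        rw [hC, mul_assoc _ _ (∫ x in openTri t, polyFun (P t) x ^ 2)]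
        refine (mul_le_mul_of_nonneg_right h1 (sq_nonneg _)).trans ?_
        rw [mul_assoc]
        gcongr)
    calc ∑ u ∈ T, volume.real (openTri u) *
          (4 * (∑ z ∈ u, D * ∑ t ∈ T with z ∈ t, |polyFun (P t) z|) ^ 2)
        = 4 * D ^ 2 * ∑ u ∈ T, volume.real (openTri u) *
          (∑ z ∈ u, ∑ t ∈ T with z ∈ t, |polyFun (P t) z|) ^ 2 := by
          rw [Finset.mul_sum]
          refine Finset.sum_congr rfl fun u _ => ?_
          rw [← Finset.mul_sum]
          ring
      _ ≤ 4 * D ^ 2 * (9 * (starBound ρ : ℝ) ^ 2 * C *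
          ∑ t ∈ T, ∫ x in openTri t, polyFun (P t) x ^ 2) := by gcongr
      _ = _ := by
          rw [hD]
          linear_combination (-(36 * (starBound ρ : ℝ) ^ 2 *
            (13 / ρ * (2 * starBound ρ + 2) * (invThetaMin K + 1)) ^ 2 *
            ∑ t ∈ T, ∫ x in openTri t, polyFun (P t) x ^ 2)) * Real.sq_sqrt hCpos.le
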